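/- Let $n\ge 1$, $p>1$, $A\in SL_n(\mathbb R)$, and let $f\in W^{1,p}(\mathbb R^n)$, that is, $f$ is locally integrable on $\mathbb R^n$ with a weak gradient $\nabla f\in L^p(\mathbb R^n;\mathbb R^n)$ (this contains all $f\in L^p$ with $\nabla f\in L^p$). Put $f_A(x)=f(Ax)$. For a convex body $K\subset\mathbb R^n$ with the origin in its interior and support function $h_K(y)=\max_{z\in K}\langle y,z\rangle$, the Wulff Laplacian is the distribution $$\Delta_{p,K}f=-\operatorname{div}\Big(\nabla\big(\tfrac1p h_K^p\big)(\nabla f)\Big),$$ where $\nabla(\tfrac1p h_K^p)$ is read as $0$ at points where $h_K^p$ is not differentiable. The affine $p$-Laplacian is the distribution $$\Delta^{\mathcal A}_pf=-\operatorname{div}\big(H_f^{p-1}(\nabla f)\,\nabla H_f(\nabla f)\big),\qquad H_f^p(v)=c_{n,p}^{-n}\,\mathcal E_p(f)^{p+n}\int_{S^{n-1}}\|\nabla_\xi f\|_p^{-n-p}\,|\langle\xi,v\rangle|^p\,d\xi,$$ where the field is $0$ where $\nabla f=0$, $\nabla_\xi f=\langle\nabla f,\xi\rangle$, $\mathcal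 E_p(f)=c_{n,p}\big(\int_{S^{n-1}}\|\nabla_\xi f\|_p^{-n}d\xi\big)^{-1/n}$, $c_{n,p}=(n\omega_n)^{1/n}\Big(\frac{n\,\omega_n\,\omega_{p-1}}{2\,\omega_{n+p-2}}\Big)^{1/p}$, $\omega_k=\pi^{k/2}/\Gamma(\tfrac k2+1)$; if $\nabla f=0$ almost everywhere, then $\mathcal E_p(f)=0$ and $H_f=0$. For a distribution $T$ on $\mathbb R^n$ and an invertible linear map $L$, the distribution $T\circ L$, also written $T(Lx)$, is $\langle T\circ L,\varphi\rangle=|\det L|^{-1}\langle T,\varphi\circ L^{-1}\rangle$. Then $f_A\in W^{1,p}(\mathbb R^n)$ and $\lambda f\in W^{1,p}(\mathbb R^n)$ for all $\lambda>0$; the function $H_f$ is differentiable on $\mathbb R^n\setminus\{0\}$, and the field $H_f^{p-1}(\nabla f)\nabla H_f(\nabla f)$ is locally integrable; and the following hold as identities between distributions on $\mathbb R^n$. (a) For every convex body $K\subset\mathbb R^n$ with the origin in its interior, $$\Delta_{p,AK}f(x)=(\Delta_{p,K}f_A)(A^{-1}x).$$ Here the fields $\nabla(\tfrac1p h_{AK}^p)(\nabla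 f)$ and $\nabla(\tfrac1p h_K^p)(\nabla f_A)$ are locally integrable, and $h_{AK}^p$ is differentiable at $\nabla f(x)$ for almost every $x$ if and only if $h_K^p$ is differentiable at $\nabla f_A(x)$ for almost every $x$. (b) $\Delta^{\mathcal A}_pf_A(x)=(\Delta^{\mathcal A}_pf)(Ax)$. (c) $\Delta^{\mathcal A}_p(\lambda f)=\lambda^{p-1}\,\Delta^{\mathcal A}_pf$ for every $\lambda>0$. -/

import Mathlib

open MeasureTheory TopologicalSpace Set Metric
open scoped Distributions LineDeriv ENNReal InnerProductSpace

noncomputable section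

namespace AffinePLaplace

/-- `ℝⁿ` with its Euclidean structure. -/
abbrev Rn (n : ℕ) : Type := EuclideanSpace ℝ (Fin n)

/-- The invertible linear map `x ↦ A x` of `ℝⁿ` given by `A ∈ SL_n(ℝ)`. -/
def slMap {n : ℕ} (A : Matrix.SpecialLinearGroup (Fin n) ℝ) : Rn n ≃L[ℝ] Rn n :=
  ContinuousLinearEquiv.equivOfInverse
    (Matrix.toEuclideanCLM (n := Fin n) (𝕜 := ℝ) (A : Matrix (Fin n) (Fin n) ℝ))
    (Matrix.toEuclideanCLM (n := Fin n) (𝕜 := ℝ)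
      ((A⁻¹ : Matrix.SpecialLinearGroup (Fin n) ℝ) : Matrix (Fin n) (Fin n) ℝ))
    (fun x => by
      rw [← mul_apply_eq_comp, ← map_mul,
        ← Matrix.SpecialLinearGroup.coe_mul, inv_mul_cancel]
      simp)
    (fun x => by
      rw [← mul_apply_eq_comp, ← map_mul,
        ← Matrix.SpecialLinearGroup.coe_mul, mul_inv_cancel]
      simp)

/-! ### Distributions on `ℝⁿ` -/

/-- The regular distribution `φ ↦ ∫ φ u` of a locally integrable function `u`
(the zero distribution if `u` is not locally integrable). -/
def regular {n : ℕ} (u : Rn n → ℝ) : 𝓓'((⊤ : Opens (Rn n)), ℝ) :=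
  TestFunction.integralAgainstBilinCLM (ContinuousLinearMap.mul ℝ ℝ) volume u

/-- The distributional divergence `∑ᵢ ∂ᵢ Vᵢ` of a locally integrable vector field `V`. -/
def divergence {n : ℕ} (V : Rn n → Rn n) : 𝓓'((⊤ : Opens (Rn n)), ℝ) :=
  ∑ i : Fin n, ∂_{EuclideanSpace.single i (1 : ℝ)} (regular fun x => V x i)

/-- The map `φ ↦ φ ∘ L` on test functions supported in a fixed compact set. -/
def pullbackSupportedIn {n : ℕ} (L : Rn n ≃L[ℝ] Rn n) (K : Compacts (Rn n)) :
    𝓓_{K}(Rn n, ℝ) →L[ℝ] 𝓓_{K.map L.symm L.symm.continuous}(Rn n, ℝ) :=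
  ContDiffMapSupportedIn.mkCLM ℝ (fun φ x => φ (L x))
    (fun _ _ _ => rfl) (fun _ _ _ => rfl)
    (fun φ => φ.contDiff.comp L.contDiff)
    (fun φ x hx => φ.zero_on_compl (fun h => hx ⟨L x, h, by simp⟩))
    (fun i _ => by
      refine ⟨{i}, ∏ _j : Fin i, ‖(L : Rn n →L[ℝ] Rn n)‖, by positivity, fun φ x _ => ?_⟩
      have h := ContinuousLinearMap.iteratedFDeriv_comp_right (L : Rn n →L[ℝ] Rn n)
        (f := φ) φ.contDiff x (i := i) (by exact_mod_cast le_top)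
      have h' : iteratedFDeriv ℝ i (fun x => φ (L x)) x =
          (iteratedFDeriv ℝ i φ (L x)).compContinuousLinearMap
            fun _ => (L : Rn n →L[ℝ] Rn n) := h
      rw [h']
      refine (ContinuousMultilinearMap.norm_compContinuousLinearMap_le _ _).trans ?_
      rw [mul_comm, Finset.sup_singleton]
      gcongr
      exact ContDiffMapSupportedIn.norm_iteratedFDeriv_apply_le_seminorm_top ℝ)

/-- The map `φ ↦ φ ∘ L` on test functions, for an invertible linear map `L`. -/
def pullback {n : ℕ} (L : Rn n ≃L[ℝ] Rn n) :
    𝓓((⊤ : Opens (Rn n)), ℝ) →L[ℝ] 𝓓((⊤ : Opens (Rn n)), ℝ) :=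
  TestFunction.limitCLM ℝ
    (fun φ => ⟨fun x => φ (L x), φ.contDiff.comp L.contDiff,
      φ.hasCompactSupport.comp_homeomorph L.toHomeomorph, subset_univ _⟩)
    (fun K _ => (TestFunction.ofSupportedInCLM ℝ (subset_univ _)).comp
      (pullbackSupportedIn L K))
    (fun _ _ _ => rfl)

/-- The distribution `T ∘ L` for an invertible linear map `L` of `ℝⁿ`:
`⟨T ∘ L, φ⟩ = |det L|⁻¹ ⟨T, φ ∘ L⁻¹⟩`. -/
def compLinear {n : ℕ} (T : 𝓓'((⊤ : Opens (Rn n)), ℝ)) (L : Rn n ≃L[ℝ] Rn n) :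
    𝓓'((⊤ : Opens (Rn n)), ℝ) :=
  |LinearMap.det (L : Rn n →ₗ[ℝ] Rn n)|⁻¹ • (pullback L.symm).precompCompactConvergenceCLM ℝ T

/-! ### Sobolev functions -/

/-- `g` is a weak gradient of `f` on `ℝⁿ`: both are locally integrable and `∂ᵢ f = gᵢ` in the
sense of distributions for every `i`. -/
def HasWeakGradient {n : ℕ} (f : Rn n → ℝ) (g : Rn n → Rn n) : Prop :=
  LocallyIntegrable f ∧ LocallyIntegrable g ∧
    ∀ i : Fin n, ∂_{EuclideanSpace.single i (1 : ℝ)} (regular f) = regular fun x => g x i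

open Classical in
/-- The weak gradient of `f`, which is unique up to a null set (`0` if there is none). -/
def weakGradient {n : ℕ} (f : Rn n → ℝ) : Rn n → Rn n :=
  if h : ∃ g, HasWeakGradient f g then h.choose else 0

/-- Weakly differentiable functions on `ℝⁿ` with gradient in `L^p`. No integrability of `f` itself
beyond local integrability is asked for, so that the functions of the smaller space
`{f ∈ L^p : ∇f ∈ L^p}` are included for every `p ≥ 1`. -/
def MemW1 {n : ℕ} (p : ℝ) (f : Rn n → ℝ) : Prop :=
  ∃ g, HasWeakGradient f g ∧ MemLp g (ENNReal.ofReal p)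

/-! ### The Wulff Laplacian -/

/-- The support function `h_K(y) = max {⟨y, z⟩ : z ∈ K}`. -/
def supportFn {n : ℕ} (K : Set (Rn n)) (y : Rn n) : ℝ :=
  sSup ((fun z => ⟪y, z⟫_ℝ) '' K)

/-- The function `h_K^p / p`. -/
def supportEnergy {n : ℕ} (p : ℝ) (K : Set (Rn n)) (y : Rn n) : ℝ :=
  supportFn K y ^ p / p

/-- The vector field `x ↦ ∇(h_K^p / p)(∇f(x))`, with value `0` at the points `x` for which
`h_K^p / p` is not differentiable at `∇f(x)` (none if `K` is strictly convex). -/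
def wulffField {n : ℕ} (p : ℝ) (K : Set (Rn n)) (f : Rn n → ℝ) (x : Rn n) : Rn n :=
  gradient (supportEnergy p K) (weakGradient f x)

/-- The vector field `x ↦ ∇(h_K^p / p)(∇f(x))` makes sense: `h_K^p / p` is differentiable at
`∇f(x)` for almost every `x`. -/
def WulffDefined {n : ℕ} (p : ℝ) (K : Set (Rn n)) (f : Rn n → ℝ) : Prop :=
  ∀ᵐ x, DifferentiableAt ℝ (supportEnergy p K) (weakGradient f x)

/-- The Wulff Laplacian `Δ_{p,K} f = -div (∇(h_K^p / p)(∇f))`, as a distribution. -/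
def wulffLaplacian {n : ℕ} (p : ℝ) (K : Set (Rn n)) (f : Rn n → ℝ) :
    𝓓'((⊤ : Opens (Rn n)), ℝ) :=
  -divergence (wulffField p K f)

/-! ### The affine `p`-Laplacian -/

/-- The volume `ω_k = π^{k/2} / Γ(k/2 + 1)` of the unit ball in dimension `k` (real `k > -2`). -/
def ballVol (k : ℝ) : ℝ := Real.pi ^ (k / 2) / Real.Gamma (k / 2 + 1)

/-- The constant `c_{n,p} = (n ω_n)^{1/n} (n ω_n ω_{p-1} / (2 ω_{n+p-2}))^{1/p}`. -/
def affineConst (n : ℕ) (p : ℝ) : ℝ :=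
  (n * ballVol n) ^ (1 / (n : ℝ)) *
    (n * ballVol n * ballVol (p - 1) / (2 * ballVol (n + p - 2))) ^ (1 / p)

/-- `‖∇_ξ f‖_p`, the `L^p` norm of `x ↦ ⟨∇f(x), ξ⟩`. -/
def dirNorm {n : ℕ} (p : ℝ) (f : Rn n → ℝ) (ξ : Rn n) : ℝ≥0∞ :=
  eLpNorm (fun x => ⟪weakGradient f x, ξ⟫_ℝ) (ENNReal.ofReal p) volume

/-- The affine energy `𝓔_p(f) = c_{n,p} (∫_{S^{n-1}} ‖∇_ξ f‖_p^{-n} dξ)^{-1/n}`. -/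
def affineEnergy {n : ℕ} (p : ℝ) (f : Rn n → ℝ) : ℝ≥0∞ :=
  ENNReal.ofReal (affineConst n p) *
    (∫⁻ ξ : sphere (0 : Rn n) 1, dirNorm p f ξ ^ (-(n : ℝ))
      ∂(volume : Measure (Rn n)).toSphere) ^ (-(1 / (n : ℝ)))

/-- `H_f`, where
`H_f(v)^p = c_{n,p}^{-n} 𝓔_p(f)^{p+n} ∫_{S^{n-1}} ‖∇_ξ f‖_p^{-n-p} |⟨ξ, v⟩|^p dξ`.
If `∇f = 0` almost everywhere then `𝓔_p(f) = 0` and `H_f = 0`. -/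
def affineH {n : ℕ} (p : ℝ) (f : Rn n → ℝ) (v : Rn n) : ℝ :=
  ((ENNReal.ofReal (affineConst n p) ^ (-(n : ℝ)) * affineEnergy p f ^ (p + n) *
    ∫⁻ ξ : sphere (0 : Rn n) 1, dirNorm p f ξ ^ (-(n : ℝ) - p) * ‖⟪(ξ : Rn n), v⟫_ℝ‖ₑ ^ p
      ∂(volume : Measure (Rn n)).toSphere) ^ (1 / p)).toReal

/-- The vector field `x ↦ H_f(∇f(x))^{p-1} ∇H_f(∇f(x))`; it vanishes where `∇f(x) = 0`. -/
def affineField {n : ℕ} (p : ℝ) (f : Rn n → ℝ) (x : Rn n) : Rn n :=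
  affineH p f (weakGradient f x) ^ (p - 1) • gradient (affineH p f) (weakGradient f x)

/-- The affine `p`-Laplacian `Δ^𝓐_p f = -div (H_f^{p-1}(∇f) ∇H_f(∇f))`, as a distribution. -/
def affineLaplacian {n : ℕ} (p : ℝ) (f : Rn n → ℝ) : 𝓓'((⊤ : Opens (Rn n)), ℝ) :=
  -divergence (affineField p f)

end AffinePLaplace

end

noncomputable section

namespace AffinePLaplace

/-! ### Polar coordinates and integrals of homogeneous functions over the sphere -/

/-! Write `L` for a linear map with `|det L| = 1`; it preserves Lebesgue measure, and everything
comes down to how gradients and vector fields transform under it. Testing against `φ ∘ L⁻¹` gives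
`∇(f ∘ L)(x) = Lᵀ ∇f(Lx)` almost everywhere (`HasWeakGradient.comp`) and `(div V) ∘ L = div (L⁻¹ V(L
·))` (`compLinear_divergence`). Each identity between Laplacians is therefore an almost everywhere
identity between locally integrable fields.

For (a), `h_{LK}(y) = h_K(Lᵀ y)`, and the chain rule carries one Wulff field to the other.

For (b), the substitution gives `‖∇_ξ (f ∘ L)‖_p = ‖∇_{Lξ} f‖_p`. Both integrands over the sphere,
extended to the whole space, are homogeneous of degree `-n`; the sphere integral of such a function
is, up to the factor `log 2`, its integral over any shell `{1 ≤ h < 2}` with `h` positive and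
1-homogeneous, hence is invariant under `L` (`lintegral_sphere_comp`). So `𝓔_p` is invariant and
`H_{f ∘ L}(v) = H_f(L⁻ᵀ v)`.

For (c), the powers of `λ` in `H_{λf}` cancel, so `H_{λf} = H_f`; this function is 1-homogeneous and
its gradient 0-homogeneous.

Regularity of `H_f` rests on the linear map `T : ξ ↦ ⟨∇f, ξ⟩` into `L^p`. If `T` has a kernel, the
sphere integral of `‖Tξ‖^{-n}` diverges and `H_f = 0`. Otherwise `‖Tξ‖` is bounded below on the
sphere, `H_f^p` is the moment of a positive bounded weight, and it can be differentiated under the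
integral sign (`MemW1.affineH_eq_zero_or`). The fields are locally integrable because they grow at
most like `(1 + |∇f|)^p`. -/

theorem measure_eq_top_of_add_mem {E : Type*} [NormedAddCommGroup E]
    [NormedSpace ℝ E] [MeasurableSpace E] [BorelSpace E] (μ : Measure E) [μ.IsAddHaarMeasure]
    {U : Set E} (hU : IsOpen U) (h0 : (0 : E) ∈ U) {z : E}
    (hz : z ≠ 0) (h : ∀ x ∈ U, ∀ t : ℝ, x + t • z ∈ U) : μ U = ⊤ := by
  obtain ⟨ε, hε, hball⟩ := Metric.isOpen_iff.1 hU 0 h0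
  have hz' : 0 < ‖z‖ := norm_pos_iff.2 hz
  -- Centres on the line `ℝ z` at mutual distance at least `2ε`: the balls of radius `ε` around them
  -- are disjoint, lie in `U` and have equal positive measure.
  set c : ℕ → E := fun k => ((2 * ε / ‖z‖) * k) • z with hc
  have hdist : ∀ i j : ℕ, i ≠ j → 2 * ε ≤ dist (c i) (c j) := fun i j hij => by
    rw [dist_eq_norm, hc, ← sub_smul, norm_smul, ← mul_sub, norm_mul, Real.norm_of_nonneg
      (by positivity), mul_right_comm, div_mul_cancel₀ _ hz'.ne', Real.norm_eq_abs]
    have : (1 : ℝ) ≤ |(i : ℝ) - j| := by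
      have h1 : (1 : ℤ) ≤ |(i : ℤ) - j| := Int.one_le_abs (by omega)
      exact_mod_cast h1
    nlinarith
  have hdisj : Pairwise (Function.onFun Disjoint fun k => ball (c k) ε) := fun i j hij =>
    ball_disjoint_ball (by linarith [hdist i j hij])
  have hsub : (⋃ k, ball (c k) ε) ⊆ U := by
    refine iUnion_subset fun k x hx => ?_
    have := h (x - c k) (hball (by simpa [dist_eq_norm] using hx)) ((2 * ε / ‖z‖) * k)
    simpa [hc] using this
  refine top_unique (le_trans ?_ (measure_mono hsub))
  rw [measure_iUnion hdisj fun k => measurableSet_ball]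
  simp_rw [Measure.addHaar_ball_center]
  rw [ENNReal.tsum_const_eq_top_of_ne_zero (measure_ball_pos μ 0 hε).ne']

section Polar

variable {E : Type*} [NormedAddCommGroup E] [NormedSpace ℝ E] [MeasurableSpace E] [BorelSpace E]
  [FiniteDimensional ℝ E] [Nontrivial E] (μ : Measure E) [μ.IsAddHaarMeasure]

theorem lintegral_volumeIoiPow (k : ℕ) {G : ℝ → ℝ≥0∞} (hG : Measurable G) :
    ∫⁻ r : Ioi (0 : ℝ), G r ∂Measure.volumeIoiPow k =
      ∫⁻ r in Ioi (0 : ℝ), ENNReal.ofReal (r ^ k) * G r := by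
  rw [Measure.volumeIoiPow, lintegral_withDensity_eq_lintegral_mul _ (by fun_prop) (by fun_prop),
    ← lintegral_subtype_comap measurableSet_Ioi]
  rfl

theorem lintegral_polar {G : E → ℝ≥0∞} (hG : Measurable G) :
    ∫⁻ x, G x ∂μ = ∫⁻ ξ : sphere (0 : E) 1, (∫⁻ r in Ioi (0 : ℝ),
      ENNReal.ofReal (r ^ (Module.finrank ℝ E - 1)) * G (r • (ξ : E))) ∂μ.toSphere := by
  have h := μ.measurePreserving_homeomorphUnitSphereProd.lintegral_comp_emb
    (Homeomorph.measurableEmbedding _) (fun q => G ((q.2 : ℝ) • (q.1 : E)))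
  have h' : ∀ x : ({0}ᶜ : Set E), (((homeomorphUnitSphereProd E x).2 : ℝ) •
      ((homeomorphUnitSphereProd E x).1 : E)) = x := fun x => by
    have := congrArg Subtype.val ((homeomorphUnitSphereProd E).symm_apply_apply x)
    rwa [homeomorphUnitSphereProd_symm_apply_coe] at this
  simp_rw [h'] at h
  rw [lintegral_subtype_comap (measurableSet_singleton (0 : E)).compl G,
    restrict_compl_singleton, lintegral_prod _ (by fun_prop)] at h
  rw [h]
  refine lintegral_congr fun ξ => ?_
  exact lintegral_volumeIoiPow _ (G := fun r => G (r • (ξ : E))) (by fun_prop)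

/-- The measure `dr / r` is invariant under dilation, so the value does not depend on `a`; this
makes shell integrals independent of the gauge. -/
theorem lintegral_Ico_inv {a : ℝ} (ha : 0 < a) :
    ∫⁻ r in Ico (1 / a) (2 / a), ENNReal.ofReal r⁻¹ = ENNReal.ofReal (Real.log 2) := by
  have h1 : 0 < 1 / a := by positivity
  have h2 : 1 / a ≤ 2 / a := by gcongr; norm_num
  have hi : IntervalIntegrable (fun r : ℝ => r⁻¹) volume (1 / a) (2 / a) :=
    intervalIntegrable_inv_iff.2 (Or.inr fun h => by
      rw [uIcc_of_le h2] at h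
      exact absurd h.1 (not_le.2 h1))
  rw [Measure.restrict_congr_set Ico_ae_eq_Ioc, ← ofReal_integral_eq_lintegral_ofReal hi.1,
    ← intervalIntegral.integral_of_le h2, integral_inv_of_pos h1 (by positivity)]
  · congr 2
    field_simp
  · filter_upwards [ae_restrict_mem measurableSet_Ioc] with r hr
    exact inv_nonneg.2 (h1.trans hr.1).le

/-- The integral of a function homogeneous of degree `-dim E` over a shell
`{1 ≤ h < 2}` does not depend on the gauge `h`. -/
theorem lintegral_shell {F : E → ℝ≥0∞} (hF : Measurable F)
    (hom : ∀ r : ℝ, 0 < r → ∀ x, F (r • x) = ENNReal.ofReal (r ^ Module.finrank ℝ E)⁻¹ * F x)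
    {h : E → ℝ} (hh : Measurable h) (h_hom : ∀ r : ℝ, 0 < r → ∀ x, h (r • x) = r * h x)
    (h_pos : ∀ x, x ≠ 0 → 0 < h x) :
    ∫⁻ x in h ⁻¹' Ico 1 2, F x ∂μ =
      ENNReal.ofReal (Real.log 2) * ∫⁻ ξ : sphere (0 : E) 1, F ξ ∂μ.toSphere := by
  have hm : MeasurableSet (h ⁻¹' Ico 1 2) := hh measurableSet_Ico
  rw [← lintegral_indicator hm, lintegral_polar μ (hF.indicator hm), ← lintegral_const_mul]
  swap
  · fun_prop
  refine lintegral_congr fun ξ => ?_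
  have ha : 0 < h ξ := h_pos _ (ne_zero_of_mem_unit_sphere ξ)
  -- On the ray through `ξ` the Jacobian `r^(dim E - 1)` and the homogeneity factor `r^(-dim E)`
  -- leave `1 / r`, and the shell cuts out `[1 / h ξ, 2 / h ξ)`.
  have key : ∀ r ∈ Ioi (0 : ℝ), ENNReal.ofReal (r ^ (Module.finrank ℝ E - 1)) *
      (h ⁻¹' Ico 1 2).indicator F (r • (ξ : E)) =
      (Ico (1 / h ξ) (2 / h ξ)).indicator (fun r => ENNReal.ofReal r⁻¹ * F ξ) r := fun r hr => by
    have hr : 0 < r := hr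
    have hiff : r • (ξ : E) ∈ h ⁻¹' Ico 1 2 ↔ r ∈ Ico (1 / h ξ) (2 / h ξ) := by
      rw [mem_preimage, h_hom r hr, mem_Ico, mem_Ico, div_le_iff₀ ha, lt_div_iff₀ ha]
    by_cases hc : r ∈ Ico (1 / h ξ) (2 / h ξ)
    · rw [indicator_of_mem hc, indicator_of_mem (hiff.2 hc), hom r hr, ← mul_assoc,
        ← ENNReal.ofReal_mul (by positivity)]
      congr 2
      obtain ⟨k, hk⟩ : ∃ k, Module.finrank ℝ E = k + 1 :=
        Nat.exists_eq_succ_of_ne_zero Module.finrank_pos.ne'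
      rw [hk, Nat.add_sub_cancel]
      field_simp
      exact (pow_succ r k).symm
    · rw [indicator_of_notMem hc, indicator_of_notMem (hiff.not.2 hc), mul_zero]
  rw [setLIntegral_congr_fun measurableSet_Ioi key, setLIntegral_indicator measurableSet_Ico,
    inter_eq_self_of_subset_left, lintegral_mul_const _ (by fun_prop), lintegral_Ico_inv ha]
  exact fun r hr => lt_of_lt_of_le (by positivity) hr.1

/-- `L` maps the shell of the gauge `‖x‖` onto that of `‖L⁻¹ x‖` and preserves `μ`. Apply
`lintegral_shell` to `F ∘ L` on the first and to `F` on the second, then cancel `log 2`. -/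
theorem lintegral_sphere_comp {F : E → ℝ≥0∞} (hF : Measurable F)
    (hom : ∀ r : ℝ, 0 < r → ∀ x, F (r • x) = ENNReal.ofReal (r ^ Module.finrank ℝ E)⁻¹ * F x)
    {L : E ≃L[ℝ] E} (hL : MeasurePreserving L μ μ) :
    ∫⁻ ξ : sphere (0 : E) 1, F (L ξ) ∂μ.toSphere = ∫⁻ ξ : sphere (0 : E) 1, F ξ ∂μ.toSphere := by
  have h1 := lintegral_shell μ hF hom (h := fun x => ‖L.symm x‖)
    (by fun_prop) (fun r hr x => by simp [norm_smul, abs_of_pos hr]) (fun x hx => by simpa)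
  have h2 := lintegral_shell μ (F := fun x => F (L x)) (by fun_prop)
    (fun r hr x => by rw [map_smul, hom r hr]) (h := fun x => ‖x‖)
    (by fun_prop) (fun r hr x => by simp [norm_smul, abs_of_pos hr]) (fun x hx => by simpa)
  have h3 := hL.setLIntegral_comp_emb L.toHomeomorph.measurableEmbedding F
    ((fun x => ‖x‖) ⁻¹' Ico 1 2)
  have h4 : L '' ((fun x => ‖x‖) ⁻¹' Ico 1 2) = (fun x => ‖L.symm x‖) ⁻¹' Ico 1 2 := by
    ext x
    constructor
    · rintro ⟨y, hy, rfl⟩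
      simpa using hy
    · exact fun hx => ⟨L.symm x, hx, by simp⟩
  have h0 : ENNReal.ofReal (Real.log 2) ≠ 0 := by
    simpa using Real.log_pos (by norm_num : (1 : ℝ) < 2)
  rw [← ENNReal.mul_right_inj h0 ENNReal.ofReal_ne_top, ← h1, ← h2, ← h4]
  exact h3

/-- A linear map with a kernel has an infinite negative moment of order `dim E` on the sphere. -/
theorem lintegral_sphere_enorm_rpow_eq_top {F : Type*} [NormedAddCommGroup F] [NormedSpace ℝ F]
    (T : E →L[ℝ] F) {z : E} (hz : z ≠ 0) (hTz : T z = 0) :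
    ∫⁻ ξ : sphere (0 : E) 1, ‖T ξ‖ₑ ^ (-(Module.finrank ℝ E : ℝ)) ∂μ.toSphere = ⊤ := by
  -- `U` is a cylinder along `ℝ z`, so it has infinite measure; in polar coordinates this measure is
  -- at most the integral in question.
  set U : Set E := {x | ‖T x‖ < 1} with hU
  have hUo : IsOpen U := isOpen_lt (by fun_prop) continuous_const
  have htop : μ U = ⊤ := measure_eq_top_of_add_mem μ hUo (by simp [hU]) hz
    fun x hx t => by simpa [hU, hTz] using hx
  refine top_unique (htop.symm.le.trans ?_)
  rw [← lintegral_indicator_one hUo.measurableSet,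
    lintegral_polar μ (measurable_one.indicator hUo.measurableSet)]
  refine lintegral_mono fun ξ => ?_
  obtain ⟨k, hk⟩ : ∃ k, Module.finrank ℝ E = k + 1 :=
    Nat.exists_eq_succ_of_ne_zero Module.finrank_pos.ne'
  rcases eq_or_ne (T ξ) 0 with h0 | h0
  · rw [h0, enorm_zero, ENNReal.zero_rpow_of_neg (by rw [hk]; push_cast; linarith)]
    exact le_top
  have ha : 0 < ‖T ξ‖ := norm_pos_iff.2 h0
  have hb : 0 < ‖T ξ‖⁻¹ := inv_pos.2 ha
  -- The crude bound `r^k ≤ ‖T ξ‖^(-k)` on an interval of length `‖T ξ‖⁻¹` already yields the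
  -- required power `-(k + 1)`.
  have key : ∀ r ∈ Ioi (0 : ℝ), ENNReal.ofReal (r ^ (Module.finrank ℝ E - 1)) *
      U.indicator 1 (r • (ξ : E)) ≤ (Ioc 0 ‖T ξ‖⁻¹).indicator
        (fun _ => ENNReal.ofReal (‖T ξ‖⁻¹ ^ k)) r := fun r hr => by
    have hr : 0 < r := hr
    by_cases hm : r • (ξ : E) ∈ U
    · have hle : r ≤ ‖T ξ‖⁻¹ := by
        have : r * ‖T ξ‖ < 1 := by simpa [hU, norm_smul, abs_of_pos hr] using hm
        rw [← one_div, le_div_iff₀ ha]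
        exact this.le
      rw [indicator_of_mem hm, indicator_of_mem (show r ∈ Ioc 0 ‖T ξ‖⁻¹ from ⟨hr, hle⟩), hk, Nat.add_sub_cancel]
      simp only [Pi.one_apply, mul_one]
      gcongr
    · rw [indicator_of_notMem hm, mul_zero]
      exact zero_le
  refine (setLIntegral_mono' measurableSet_Ioi key).trans ?_
  rw [setLIntegral_indicator measurableSet_Ioc]
  refine (lintegral_mono_set inter_subset_left).trans ?_
  rw [setLIntegral_const, Real.volume_Ioc, sub_zero, ← ENNReal.ofReal_mul (by positivity),
    ← pow_succ, ← hk, ENNReal.rpow_neg, ENNReal.rpow_natCast, ← ofReal_norm,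
    ← ENNReal.ofReal_pow ha.le, ← ENNReal.ofReal_inv_of_pos (by positivity), inv_pow]

end Polar

variable {n : ℕ}

/-! ### Linear changes of variables -/

theorem det_slMap (A : Matrix.SpecialLinearGroup (Fin n) ℝ) :
    LinearMap.det (slMap A : Rn n →ₗ[ℝ] Rn n) = 1 := by
  have h : (slMap A : Rn n →ₗ[ℝ] Rn n) =
      Matrix.toLin (EuclideanSpace.basisFun (Fin n) ℝ).toBasis
        (EuclideanSpace.basisFun (Fin n) ℝ).toBasis (A : Matrix (Fin n) (Fin n) ℝ) := by
    rw [← Matrix.toEuclideanLin_eq_toLin_orthonormal]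
    rfl
  rw [h, LinearMap.det_toLin, A.det_coe]

theorem abs_det_slMap (A : Matrix.SpecialLinearGroup (Fin n) ℝ) :
    |LinearMap.det (slMap A : Rn n →ₗ[ℝ] Rn n)| = 1 := by
  rw [det_slMap, abs_one]

theorem abs_det_symm {L : Rn n ≃L[ℝ] Rn n} (hL : |LinearMap.det (L : Rn n →ₗ[ℝ] Rn n)| = 1) :
    |LinearMap.det (L.symm : Rn n →ₗ[ℝ] Rn n)| = 1 := by
  have h : LinearMap.det (L.symm : Rn n →ₗ[ℝ] Rn n) * LinearMap.det (L : Rn n →ₗ[ℝ] Rn n) = 1 := by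
    rw [← LinearMap.det_comp]
    have hc : (L.symm : Rn n →ₗ[ℝ] Rn n) ∘ₗ (L : Rn n →ₗ[ℝ] Rn n) = LinearMap.id := by
      ext1 x
      simp
    rw [hc, LinearMap.det_id]
  have h' := congrArg abs h
  rwa [abs_mul, hL, mul_one, abs_one] at h'

theorem measurePreserving_of_abs_det {L : Rn n ≃L[ℝ] Rn n}
    (hL : |LinearMap.det (L : Rn n →ₗ[ℝ] Rn n)| = 1) :
    MeasurePreserving L (volume : Measure (Rn n)) volume := by
  refine ⟨L.continuous.measurable, ?_⟩
  have h0 : LinearMap.det (L : Rn n →ₗ[ℝ] Rn n) ≠ 0 := fun h => by simp [h] at hL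
  have h := Measure.map_linearMap_addHaar_eq_smul_addHaar (volume : Measure (Rn n)) h0
  rw [abs_inv, hL, inv_one, ENNReal.ofReal_one, one_smul] at h
  exact h

theorem locallyIntegrable_comp {E : Type*} [NormedAddCommGroup E] {L : Rn n ≃L[ℝ] Rn n}
    (hL : |LinearMap.det (L : Rn n →ₗ[ℝ] Rn n)| = 1) {u : Rn n → E} (hu : LocallyIntegrable u) :
    LocallyIntegrable (fun x => u (L x)) := by
  rw [locallyIntegrable_iff] at hu ⊢
  intro K hK
  have h := hu (L '' K) (hK.image L.continuous)
  have := (measurePreserving_of_abs_det hL).integrableOn_image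
    L.toHomeomorph.measurableEmbedding (f := u) (s := K)
  exact this.1 h

theorem locallyIntegrable_clm_comp {E F : Type*} [NormedAddCommGroup E] [NormedSpace ℝ E]
    [NormedAddCommGroup F] [NormedSpace ℝ F] (T : E →L[ℝ] F) {u : Rn n → E}
    (hu : LocallyIntegrable u) : LocallyIntegrable (fun x => T (u x)) := by
  rw [locallyIntegrable_iff] at hu ⊢
  exact fun K hK => T.integrable_comp (hu K hK)

/-! ### Distributions given by functions and vector fields -/

theorem locallyIntegrable_apply {V : Rn n → Rn n} (hV : LocallyIntegrable V) (i : Fin n) :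
    LocallyIntegrable (fun x => V x i) :=
  locallyIntegrable_clm_comp (EuclideanSpace.proj i : Rn n →L[ℝ] ℝ) hV

theorem regular_apply {u : Rn n → ℝ} (hu : LocallyIntegrable u)
    (φ : 𝓓((⊤ : Opens (Rn n)), ℝ)) : regular u φ = ∫ x, φ x * u x := by
  have := TestFunction.integralAgainstBilinCLM_eq_integral (Ω := (⊤ : Opens (Rn n)))
    (B := ContinuousLinearMap.mul ℝ ℝ) (μ := volume) (φ := u) (n := ⊤) (hu.locallyIntegrableOn _)
    (f := φ)
  exact this

theorem integrable_testFunction_smul {E : Type*} [NormedAddCommGroup E] [NormedSpace ℝ E]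
    {u : Rn n → E} (hu : LocallyIntegrable u)
    {φ : Rn n → ℝ} (hφ : Continuous φ) (hφ' : HasCompactSupport φ) :
    Integrable (fun x => φ x • u x) :=
  hu.integrable_smul_left_of_hasCompactSupport hφ hφ'

theorem lineDeriv_regular_apply {u : Rn n → ℝ} (hu : LocallyIntegrable u) (v : Rn n)
    (φ : 𝓓((⊤ : Opens (Rn n)), ℝ)) :
    (∂_{v} (regular u)) φ = -∫ x, fderiv ℝ φ x v * u x := by
  rw [Distribution.lineDerivOp_apply_apply, map_neg, regular_apply hu]
  congr 1

theorem fderiv_eq_sum (φ : 𝓓((⊤ : Opens (Rn n)), ℝ)) (x v : Rn n) :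
    fderiv ℝ φ x v = ∑ i, fderiv ℝ φ x (EuclideanSpace.single i (1 : ℝ)) * v i := by
  conv_lhs => rw [← (EuclideanSpace.basisFun (Fin n) ℝ).sum_repr v, map_sum]
  simp [mul_comm]

theorem integrable_fderiv_mul (φ : 𝓓((⊤ : Opens (Rn n)), ℝ)) (v : Rn n) {u : Rn n → ℝ}
    (hu : LocallyIntegrable u) : Integrable (fun x => fderiv ℝ φ x v * u x) := by
  refine integrable_testFunction_smul hu (φ := fun x => fderiv ℝ φ x v) ?_ ?_
  · exact (φ.contDiff.continuous_fderiv (by simp)).clm_apply continuous_const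
  · exact φ.hasCompactSupport.fderiv_apply ℝ v

theorem divergence_apply {V : Rn n → Rn n} (hV : LocallyIntegrable V)
    (φ : 𝓓((⊤ : Opens (Rn n)), ℝ)) : divergence V φ = -∫ x, fderiv ℝ φ x (V x) := by
  have h : divergence V φ = ∑ i : Fin n,
      (∂_{EuclideanSpace.single i (1 : ℝ)} (regular fun x => V x i)) φ := by
    simp [divergence, -Distribution.lineDerivOp_apply_apply]
  simp_rw [h, lineDeriv_regular_apply (locallyIntegrable_apply hV _), Finset.sum_neg_distrib]
  rw [← integral_finsetSum]
  · simp_rw [← fderiv_eq_sum]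
  · exact fun i _ => integrable_fderiv_mul φ _ (locallyIntegrable_apply hV i)

theorem divergence_congr {V W : Rn n → Rn n} (hV : LocallyIntegrable V) (h : V =ᵐ[volume] W) :
    divergence V = divergence W := by
  ext φ
  rw [divergence_apply hV, divergence_apply (hV.congr h)]
  congr 1
  refine integral_congr_ae ?_
  filter_upwards [h] with x hx
  rw [hx]

theorem divergence_smul {V : Rn n → Rn n} (hV : LocallyIntegrable V) (c : ℝ) :
    divergence (fun x => c • V x) = c • divergence V := by
  ext φ
  have h : (c • divergence V) φ = c * divergence V φ := rfl
  rw [h, divergence_apply hV]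
  refine (divergence_apply (hV.smul c) φ).trans ?_
  simp [integral_const_mul]

theorem pullback_apply (L : Rn n ≃L[ℝ] Rn n) (φ : 𝓓((⊤ : Opens (Rn n)), ℝ)) (x : Rn n) :
    pullback L φ x = φ (L x) := rfl

theorem fderiv_pullback (L : Rn n ≃L[ℝ] Rn n) (φ : 𝓓((⊤ : Opens (Rn n)), ℝ)) (x v : Rn n) :
    fderiv ℝ (pullback L φ) x v = fderiv ℝ φ (L x) (L v) := by
  have h : (pullback L φ : Rn n → ℝ) = φ ∘ L := rfl
  rw [h, L.comp_right_fderiv]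
  rfl

theorem compLinear_apply {L : Rn n ≃L[ℝ] Rn n} (hL : |LinearMap.det (L : Rn n →ₗ[ℝ] Rn n)| = 1)
    (T : 𝓓'((⊤ : Opens (Rn n)), ℝ)) (φ : 𝓓((⊤ : Opens (Rn n)), ℝ)) :
    compLinear T L φ = T (pullback L.symm φ) := by
  have h : compLinear T L φ =
      |LinearMap.det (L : Rn n →ₗ[ℝ] Rn n)|⁻¹ * T (pullback L.symm φ) := rfl
  rw [h, hL, inv_one, one_mul]

/-- After the substitution `x ↦ L x`, the chain rule for `φ ∘ L⁻¹` moves `L⁻¹` from the test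
function onto the field. -/
theorem compLinear_divergence {L : Rn n ≃L[ℝ] Rn n}
    (hL : |LinearMap.det (L : Rn n →ₗ[ℝ] Rn n)| = 1) {V : Rn n → Rn n}
    (hV : LocallyIntegrable V) :
    compLinear (divergence V) L = divergence fun x => L.symm (V (L x)) := by
  ext φ
  have hW : LocallyIntegrable fun x => L.symm (V (L x)) :=
    locallyIntegrable_clm_comp (L.symm : Rn n →L[ℝ] Rn n) (locallyIntegrable_comp hL hV)
  rw [compLinear_apply hL, divergence_apply hV, divergence_apply hW]
  congr 1
  rw [← (measurePreserving_of_abs_det hL).integral_comp L.toHomeomorph.measurableEmbedding]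
  simp [fderiv_pullback]

theorem compLinear_neg_divergence {L : Rn n ≃L[ℝ] Rn n}
    (hL : |LinearMap.det (L : Rn n →ₗ[ℝ] Rn n)| = 1) {V : Rn n → Rn n}
    (hV : LocallyIntegrable V) :
    compLinear (-divergence V) L = -divergence fun x => L.symm (V (L x)) := by
  rw [← compLinear_divergence hL hV]
  ext φ
  have h : (-compLinear (divergence V) L) φ = -(compLinear (divergence V) L φ) := rfl
  rw [h, compLinear_apply hL, compLinear_apply hL]
  rfl

/-! ### Weak gradients -/

/-- A basis-free form of the definition: a linear change of variables turns coordinate directions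
into arbitrary ones. -/
theorem hasWeakGradient_iff {f : Rn n → ℝ} {g : Rn n → Rn n} :
    HasWeakGradient f g ↔ LocallyIntegrable f ∧ LocallyIntegrable g ∧
      ∀ (φ : 𝓓((⊤ : Opens (Rn n)), ℝ)) (v : Rn n),
        -∫ x, fderiv ℝ φ x v * f x = ∫ x, φ x * ⟪g x, v⟫_ℝ := by
  refine and_congr_right fun hf => and_congr_right fun hg => ⟨fun h φ v => ?_, fun h i => ?_⟩
  · have key : ∀ i, -∫ x, fderiv ℝ φ x (EuclideanSpace.single i (1 : ℝ)) * f x =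
        ∫ x, φ x * g x i := fun i => by
      rw [← lineDeriv_regular_apply hf, h i, regular_apply (locallyIntegrable_apply hg i)]
    have hl : ∀ x, fderiv ℝ φ x v * f x =
        ∑ i, v i * (fderiv ℝ φ x (EuclideanSpace.single i (1 : ℝ)) * f x) := fun x => by
      rw [fderiv_eq_sum, Finset.sum_mul]
      exact Finset.sum_congr rfl fun i _ => by ring
    have hr : ∀ x, φ x * ⟪g x, v⟫_ℝ = ∑ i, v i * (φ x * g x i) := fun x => by
      rw [PiLp.inner_apply, Finset.mul_sum]
      exact Finset.sum_congr rfl fun i _ => by simp; ring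
    simp_rw [hl, hr]
    rw [integral_finsetSum, integral_finsetSum, ← Finset.sum_neg_distrib]
    · refine Finset.sum_congr rfl fun i _ => ?_
      rw [integral_const_mul, integral_const_mul, ← key i, mul_neg]
    · exact fun i _ => (integrable_testFunction_smul (locallyIntegrable_apply hg i)
        φ.continuous φ.hasCompactSupport).const_mul _
    · exact fun i _ => (integrable_fderiv_mul φ _ hf).const_mul _
  · ext φ
    rw [lineDeriv_regular_apply hf, regular_apply (locallyIntegrable_apply hg i), h φ]
    simp [EuclideanSpace.inner_single_right]

theorem HasWeakGradient.ae_eq {f : Rn n → ℝ} {g g' : Rn n → Rn n} (h : HasWeakGradient f g)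
    (h' : HasWeakGradient f g') : g =ᵐ[volume] g' := by
  have key : ∀ i, ∀ᵐ x, g x i = g' x i := fun i => by
    have hg := locallyIntegrable_apply h.2.1 i
    have hg' := locallyIntegrable_apply h'.2.1 i
    refine ae_eq_of_integral_contDiff_smul_eq hg hg' fun φ hφ hφ' => ?_
    have := (regular_apply hg ⟨φ, by exact_mod_cast hφ, hφ', subset_univ _⟩).symm.trans
      (congrArg (fun T => T ⟨φ, by exact_mod_cast hφ, hφ', subset_univ _⟩)
        ((h.2.2 i).symm.trans (h'.2.2 i)))
    exact this.trans (regular_apply hg' _)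
  filter_upwards [ae_all_iff.2 key] with x hx
  ext i
  exact hx i

theorem HasWeakGradient.weakGradient {f : Rn n → ℝ} {g : Rn n → Rn n} (h : HasWeakGradient f g) :
    HasWeakGradient f (weakGradient f) := by
  have h' : ∃ g, HasWeakGradient f g := ⟨g, h⟩
  rw [AffinePLaplace.weakGradient, dif_pos h']
  exact h'.choose_spec

theorem HasWeakGradient.weakGradient_ae_eq {f : Rn n → ℝ} {g : Rn n → Rn n}
    (h : HasWeakGradient f g) : AffinePLaplace.weakGradient f =ᵐ[volume] g :=
  h.weakGradient.ae_eq h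

theorem HasWeakGradient.comp {L : Rn n ≃L[ℝ] Rn n}
    (hL : |LinearMap.det (L : Rn n →ₗ[ℝ] Rn n)| = 1) {f : Rn n → ℝ} {g : Rn n → Rn n}
    (h : HasWeakGradient f g) :
    HasWeakGradient (f ∘ L)
      (fun x => ContinuousLinearMap.adjoint (L : Rn n →L[ℝ] Rn n) (g (L x))) := by
  rw [hasWeakGradient_iff] at h ⊢
  obtain ⟨hf, hg, h⟩ := h
  refine ⟨locallyIntegrable_comp hL hf,
    locallyIntegrable_clm_comp _ (locallyIntegrable_comp hL hg), fun φ v => ?_⟩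
  -- The derivative of `φ ∘ L⁻¹` at `L x` in direction `L v` is the derivative of `φ` at `x` in
  -- direction `v`.
  have key := h (pullback L.symm φ) (L v)
  rw [← (measurePreserving_of_abs_det hL).integral_comp L.toHomeomorph.measurableEmbedding
      fun x => fderiv ℝ (pullback L.symm φ) x (L v) * f x,
    ← (measurePreserving_of_abs_det hL).integral_comp L.toHomeomorph.measurableEmbedding
      fun x => pullback L.symm φ x * ⟪g x, L v⟫_ℝ] at key
  simpa [fderiv_pullback, pullback_apply, ContinuousLinearMap.adjoint_inner_left] using key

theorem HasWeakGradient.const_smul {f : Rn n → ℝ} {g : Rn n → Rn n}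
    (h : HasWeakGradient f g) (c : ℝ) : HasWeakGradient (c • f) (c • g) := by
  rw [hasWeakGradient_iff] at h ⊢
  obtain ⟨hf, hg, h⟩ := h
  refine ⟨hf.smul c, hg.smul c, fun φ v => ?_⟩
  have hl : ∀ x, fderiv ℝ φ x v * (c • f) x = c * (fderiv ℝ φ x v * f x) := fun x => by
    simp only [Pi.smul_apply, smul_eq_mul]; ring
  have hr : ∀ x, φ x * ⟪(c • g) x, v⟫_ℝ = c * (φ x * ⟪g x, v⟫_ℝ) := fun x => by
    simp only [Pi.smul_apply, real_inner_smul_left]; ring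
  simp_rw [hl, hr, integral_const_mul]
  rw [← h φ v, mul_neg]

theorem MemW1.hasWeakGradient {p : ℝ} {f : Rn n → ℝ} (hf : MemW1 p f) :
    HasWeakGradient f (weakGradient f) :=
  hf.choose_spec.1.weakGradient

theorem MemW1.memLp {p : ℝ} {f : Rn n → ℝ} (hf : MemW1 p f) :
    MemLp (weakGradient f) (ENNReal.ofReal p) :=
  hf.choose_spec.2.ae_eq hf.choose_spec.1.weakGradient_ae_eq.symm

theorem MemW1.comp {p : ℝ} {L : Rn n ≃L[ℝ] Rn n}
    (hL : |LinearMap.det (L : Rn n →ₗ[ℝ] Rn n)| = 1) {f : Rn n → ℝ} (hf : MemW1 p f) :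
    MemW1 p (f ∘ L) :=
  ⟨_, hf.hasWeakGradient.comp hL,
    (hf.memLp.comp_measurePreserving (measurePreserving_of_abs_det hL)).continuousLinearMap_comp
      (ContinuousLinearMap.adjoint (L : Rn n →L[ℝ] Rn n))⟩

theorem MemW1.const_smul {p : ℝ} {f : Rn n → ℝ} (hf : MemW1 p f) (c : ℝ) : MemW1 p (c • f) :=
  ⟨_, hf.hasWeakGradient.const_smul c, hf.memLp.const_smul c⟩

theorem MemW1.weakGradient_comp {p : ℝ} {L : Rn n ≃L[ℝ] Rn n}
    (hL : |LinearMap.det (L : Rn n →ₗ[ℝ] Rn n)| = 1) {f : Rn n → ℝ} (hf : MemW1 p f) :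
    weakGradient (f ∘ L) =ᵐ[volume]
      fun x => ContinuousLinearMap.adjoint (L : Rn n →L[ℝ] Rn n) (weakGradient f (L x)) :=
  (hf.hasWeakGradient.comp hL).weakGradient_ae_eq

theorem MemW1.weakGradient_const_smul {p : ℝ} {f : Rn n → ℝ} (hf : MemW1 p f) (c : ℝ) :
    weakGradient (c • f) =ᵐ[volume] fun x => c • weakGradient f x :=
  (hf.hasWeakGradient.const_smul c).weakGradient_ae_eq

/-! ### Local integrability from growth, and gradients under linear maps -/

/-- Composition of an `L^p` field with a measurable map of growth `p` is locally integrable. -/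
theorem locallyIntegrable_comp_of_growth {p : ℝ} (hp : 0 < p) {g Φ : Rn n → Rn n}
    (hg : MemLp g (ENNReal.ofReal p)) (hΦ : Measurable Φ) {C : ℝ}
    (hC : ∀ v, ‖Φ v‖ ≤ C * (1 + ‖v‖) ^ p) : LocallyIntegrable fun x => Φ (g x) := by
  rw [locallyIntegrable_iff]
  intro K hK
  have : IsFiniteMeasure (volume.restrict K : Measure (Rn n)) :=
    ⟨by simpa using hK.measure_lt_top⟩
  have h1 : MemLp (fun x => 1 + ‖g x‖) (ENNReal.ofReal p) (volume.restrict K) :=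
    (memLp_const (1 : ℝ)).add (hg.restrict K).norm
  have h2 := h1.integrable_norm_rpow (by simpa using hp) ENNReal.ofReal_ne_top
  rw [ENNReal.toReal_ofReal hp.le] at h2
  refine (h2.const_mul C).mono'
    (hΦ.comp_aemeasurable (hg.restrict K).aestronglyMeasurable.aemeasurable).aestronglyMeasurable ?_
  refine Filter.Eventually.of_forall fun x => ?_
  rw [Real.norm_of_nonneg (by positivity)]
  exact hC (g x)

theorem measurable_gradient (Ψ : Rn n → ℝ) : Measurable (gradient Ψ) :=
  (InnerProductSpace.toDual ℝ (Rn n)).symm.continuous.measurable.comp (measurable_fderiv ℝ Ψ)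

theorem norm_gradient (Ψ : Rn n → ℝ) (v : Rn n) : ‖gradient Ψ v‖ = ‖fderiv ℝ Ψ v‖ :=
  (InnerProductSpace.toDual ℝ (Rn n)).symm.norm_map _

theorem differentiableAt_comp_equiv {Ψ : Rn n → ℝ} {L : Rn n ≃L[ℝ] Rn n} {v : Rn n} :
    DifferentiableAt ℝ (fun w => Ψ (L w)) v ↔ DifferentiableAt ℝ Ψ (L v) :=
  L.comp_right_differentiableAt_iff

theorem gradient_comp_equiv (Ψ : Rn n → ℝ) (L : Rn n ≃L[ℝ] Rn n) (v : Rn n) :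
    gradient (fun w => Ψ (L w)) v =
      ContinuousLinearMap.adjoint (L : Rn n →L[ℝ] Rn n) (gradient Ψ (L v)) := by
  refine ext_inner_right ℝ fun w => ?_
  have h : fderiv ℝ (fun w => Ψ (L w)) v = (fderiv ℝ Ψ (L v)).comp (L : Rn n →L[ℝ] Rn n) :=
    L.comp_right_fderiv
  rw [ContinuousLinearMap.adjoint_inner_left, inner_gradient_left, inner_gradient_left, h]
  rfl

/-! ### The Wulff Laplacian -/

theorem abs_rpow_sub_rpow_le {p M a b : ℝ} (hp : 1 < p) (ha : a ∈ Icc 0 M) (hb : b ∈ Icc 0 M) :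
    |a ^ p - b ^ p| ≤ p * M ^ (p - 1) * |a - b| := by
  refine (convex_Icc (0 : ℝ) M).norm_image_sub_le_of_norm_hasDerivWithin_le (f := fun t => t ^ p)
    (f' := fun t => p * t ^ (p - 1)) (fun t _ => ?_) (fun t ht => ?_) hb ha
  · exact (Real.hasDerivAt_rpow_const (Or.inr hp.le)).hasDerivWithinAt
  · have h0 : 0 ≤ t ^ (p - 1) := Real.rpow_nonneg ht.1 _
    rw [Real.norm_of_nonneg (by positivity)]
    exact mul_le_mul_of_nonneg_left (Real.rpow_le_rpow ht.1 ht.2 (by linarith)) (by linarith)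

/-- A local Lipschitz constant bounds the derivative, also at points of non-differentiability, where
`fderiv` is `0`. The factor `R ^ (p - 1)` comes from the derivative of `t ^ p` on `[0, R(1 + ‖v‖)]`,
the other `R` from the Lipschitz bound on `h`. -/
theorem norm_fderiv_rpow_div_le {p R : ℝ} (hp : 1 < p) (hR : 0 ≤ R) {h : Rn n → ℝ}
    (h0 : ∀ v, 0 ≤ h v) (h1 : ∀ v, h v ≤ R * ‖v‖) (h2 : ∀ v w, |h v - h w| ≤ R * ‖v - w‖)
    (v : Rn n) : ‖fderiv ℝ (fun w => h w ^ p / p) v‖ ≤ R ^ (p - 1) * R * (1 + ‖v‖) ^ p := by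
  have hp0 : 0 < p := by linarith
  -- The natural growth exponent is `p - 1`; weakening it to `p` matches the integrability of
  -- `|∇f|^p`.
  have hle : (1 + ‖v‖) ^ (p - 1) ≤ (1 + ‖v‖) ^ p :=
    Real.rpow_le_rpow_of_exponent_le (by linarith [norm_nonneg v]) (by linarith)
  refine norm_fderiv_le_of_lip' ℝ (by positivity) ?_
  filter_upwards [Metric.ball_mem_nhds v one_pos] with w hw
  have hw' : ‖w‖ ≤ 1 + ‖v‖ := by
    have := norm_le_norm_add_norm_sub' w v
    rw [mem_ball, dist_eq_norm] at hw
    linarith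
  have key := abs_rpow_sub_rpow_le hp (M := R * (1 + ‖v‖)) (a := h w) (b := h v)
    ⟨h0 w, (h1 w).trans (by gcongr)⟩ ⟨h0 v, (h1 v).trans (by gcongr; linarith)⟩
  rw [← sub_div, Real.norm_eq_abs, abs_div, abs_of_pos hp0, div_le_iff₀ hp0]
  refine key.trans ?_
  rw [Real.mul_rpow hR (by positivity)]
  calc p * (R ^ (p - 1) * (1 + ‖v‖) ^ (p - 1)) * |h w - h v|
      ≤ p * (R ^ (p - 1) * (1 + ‖v‖) ^ p) * (R * ‖w - v‖) := by gcongr; exact h2 w v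
    _ = _ := by ring

theorem supportFn_image (K : Set (Rn n)) (L : Rn n ≃L[ℝ] Rn n) (y : Rn n) :
    supportFn (L '' K) y =
      supportFn K (ContinuousLinearMap.adjoint (L : Rn n →L[ℝ] Rn n) y) := by
  simp [supportFn, image_image, ContinuousLinearMap.adjoint_inner_left]

theorem supportFn_bounds {K : Set (Rn n)} (hK : Bornology.IsBounded K) (h0 : (0 : Rn n) ∈ K) :
    ∃ R, 0 ≤ R ∧ (∀ v, 0 ≤ supportFn K v) ∧ (∀ v, supportFn K v ≤ R * ‖v‖) ∧
      ∀ v w, |supportFn K v - supportFn K w| ≤ R * ‖v - w‖ := by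
  obtain ⟨R, hR0, hR⟩ := hK.exists_pos_norm_le
  have hb : ∀ v, ∀ z ∈ K, ⟪v, z⟫_ℝ ≤ R * ‖v‖ := fun v z hz => by
    refine (real_inner_le_norm v z).trans ?_
    rw [mul_comm]
    exact mul_le_mul_of_nonneg_right (hR z hz) (norm_nonneg v)
  have hbdd : ∀ v, BddAbove ((fun z => ⟪v, z⟫_ℝ) '' K) := fun v =>
    ⟨R * ‖v‖, by rintro _ ⟨z, hz, rfl⟩; exact hb v z hz⟩
  have hne : ∀ v, ((fun z => ⟪v, z⟫_ℝ) '' K).Nonempty := fun v => ⟨_, 0, h0, rfl⟩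
  have hsub : ∀ v w, supportFn K v ≤ supportFn K w + R * ‖v - w‖ := fun v w => by
    refine csSup_le (hne v) ?_
    rintro _ ⟨z, hz, rfl⟩
    have h1 : ⟪w, z⟫_ℝ ≤ supportFn K w := le_csSup (hbdd w) ⟨z, hz, rfl⟩
    have h2 := hb (v - w) z hz
    rw [inner_sub_left] at h2
    show ⟪v, z⟫_ℝ ≤ _
    linarith
  refine ⟨R, hR0.le, fun v => ?_, fun v => ?_, fun v w => ?_⟩
  · exact le_csSup (hbdd v) ⟨0, h0, by simp⟩
  · refine csSup_le (hne v) ?_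
    rintro _ ⟨z, hz, rfl⟩
    exact hb v z hz
  · rw [abs_sub_le_iff]
    have h1 := hsub v w
    have h2 := hsub w v
    rw [norm_sub_rev] at h2
    constructor <;> linarith

theorem locallyIntegrable_wulffField {p : ℝ} (hp : 1 < p) {K : Set (Rn n)}
    (hK : Bornology.IsBounded K) (h0 : (0 : Rn n) ∈ K) {f : Rn n → ℝ} (hf : MemW1 p f) :
    LocallyIntegrable (wulffField p K f) := by
  obtain ⟨R, hR, h1, h2, h3⟩ := supportFn_bounds hK h0
  refine locallyIntegrable_comp_of_growth (p := p) (g := weakGradient f)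
    (Φ := gradient (supportEnergy p K)) (by linarith) hf.memLp (measurable_gradient _) (C := R ^ (p - 1) * R) fun v => ?_
  rw [norm_gradient]
  exact norm_fderiv_rpow_div_le hp hR h1 h2 h3 v

/-- The adjoint of an invertible linear map, as an invertible linear map. -/
def adjointEquiv (L : Rn n ≃L[ℝ] Rn n) : Rn n ≃L[ℝ] Rn n :=
  ContinuousLinearEquiv.equivOfInverse (ContinuousLinearMap.adjoint (L : Rn n →L[ℝ] Rn n))
    (ContinuousLinearMap.adjoint (L.symm : Rn n →L[ℝ] Rn n))
    (fun x => ext_inner_right ℝ fun y => by simp [ContinuousLinearMap.adjoint_inner_left])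
    (fun x => ext_inner_right ℝ fun y => by simp [ContinuousLinearMap.adjoint_inner_left])

theorem coe_adjointEquiv (L : Rn n ≃L[ℝ] Rn n) :
    (adjointEquiv L : Rn n →L[ℝ] Rn n) = ContinuousLinearMap.adjoint (L : Rn n →L[ℝ] Rn n) := rfl

theorem adjointEquiv_apply (L : Rn n ≃L[ℝ] Rn n) (x : Rn n) :
    adjointEquiv L x = ContinuousLinearMap.adjoint (L : Rn n →L[ℝ] Rn n) x := rfl

theorem inner_adjointEquiv_left (L : Rn n ≃L[ℝ] Rn n) (x y : Rn n) :
    ⟪adjointEquiv L x, y⟫_ℝ = ⟪x, L y⟫_ℝ :=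
  ContinuousLinearMap.adjoint_inner_left _ _ _

theorem gradient_comp_adjointEquiv (Ψ : Rn n → ℝ) (L : Rn n ≃L[ℝ] Rn n) (v : Rn n) :
    gradient (fun w => Ψ (adjointEquiv L w)) v = L (gradient Ψ (adjointEquiv L v)) := by
  rw [gradient_comp_equiv, coe_adjointEquiv, ContinuousLinearMap.adjoint_adjoint]
  rfl

theorem supportEnergy_image (p : ℝ) (K : Set (Rn n)) (L : Rn n ≃L[ℝ] Rn n) :
    supportEnergy p (L '' K) = fun y => supportEnergy p K (adjointEquiv L y) := by
  ext y
  rw [supportEnergy, supportFn_image]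
  rfl

/-- Only an almost everywhere identity is possible, since weak gradients are determined up to null
sets; `L⁻¹` pulls null sets back to null sets. -/
theorem wulffField_image_ae {p : ℝ} (K : Set (Rn n)) {L : Rn n ≃L[ℝ] Rn n}
    (hL : |LinearMap.det (L : Rn n →ₗ[ℝ] Rn n)| = 1) {f : Rn n → ℝ} (hf : MemW1 p f) :
    (fun x => L (wulffField p K (f ∘ L) (L.symm x))) =ᵐ[volume] wulffField p (L '' K) f := by
  have h := (measurePreserving_of_abs_det (abs_det_symm hL)).quasiMeasurePreserving.ae
    (hf.weakGradient_comp hL)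
  filter_upwards [h] with x hx
  rw [wulffField, wulffField, hx, supportEnergy_image, gradient_comp_adjointEquiv,
    L.apply_symm_apply, adjointEquiv_apply]

theorem wulffDefined_image_iff {p : ℝ} (K : Set (Rn n)) {L : Rn n ≃L[ℝ] Rn n}
    (hL : |LinearMap.det (L : Rn n →ₗ[ℝ] Rn n)| = 1) {f : Rn n → ℝ} (hf : MemW1 p f) :
    WulffDefined p (L '' K) f ↔ WulffDefined p K (f ∘ L) := by
  have hi : ∀ v, DifferentiableAt ℝ (supportEnergy p (L '' K)) v ↔
      DifferentiableAt ℝ (supportEnergy p K) (adjointEquiv L v) := fun v => by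
    rw [supportEnergy_image]
    exact differentiableAt_comp_equiv
  have hg := hf.weakGradient_comp hL
  constructor <;> intro h
  · have h' := (measurePreserving_of_abs_det hL).quasiMeasurePreserving.ae h
    filter_upwards [h', hg] with x hx hgx
    rw [hgx]
    exact (hi _).1 hx
  · have hm := (measurePreserving_of_abs_det (abs_det_symm hL)).quasiMeasurePreserving
    filter_upwards [hm.ae h, hm.ae hg] with x hx hgx
    rw [hgx, L.apply_symm_apply] at hx
    exact (hi _).2 hx

theorem wulffLaplacian_image {p : ℝ} (hp : 1 < p) {K : Set (Rn n)} (hK : Bornology.IsBounded K)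
    (h0 : (0 : Rn n) ∈ K) {L : Rn n ≃L[ℝ] Rn n}
    (hL : |LinearMap.det (L : Rn n →ₗ[ℝ] Rn n)| = 1) {f : Rn n → ℝ} (hf : MemW1 p f) :
    wulffLaplacian p (L '' K) f = compLinear (wulffLaplacian p K (f ∘ L)) L.symm := by
  have hV := locallyIntegrable_wulffField hp hK h0 (hf.comp hL)
  rw [wulffLaplacian, wulffLaplacian, compLinear_neg_divergence (abs_det_symm hL) hV]
  congr 1
  refine (divergence_congr ?_ (wulffField_image_ae K hL hf)).symm
  exact locallyIntegrable_clm_comp (L : Rn n →L[ℝ] Rn n)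
    (locallyIntegrable_comp (abs_det_symm hL) hV)

/-! ### The affine energy and its gauge -/

/-- The map `ξ ↦ ⟨∇f, ξ⟩` is linear into `L^p`, and continuous because its domain is
finite-dimensional. This yields measurability of `dirNorm` and, when the map is injective, its lower
bound on the sphere. -/
theorem exists_dirNorm_eq_enorm {p : ℝ} [Fact (1 ≤ ENNReal.ofReal p)] {f : Rn n → ℝ}
    (hf : MemW1 p f) : ∃ T : Rn n →L[ℝ] Lp ℝ (ENNReal.ofReal p) (volume : Measure (Rn n)),
      ∀ ξ, dirNorm p f ξ = ‖T ξ‖ₑ := by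
  have hg : ∀ ξ : Rn n, MemLp (fun x => ⟪weakGradient f x, ξ⟫_ℝ) (ENNReal.ofReal p) :=
    fun ξ => hf.memLp.inner_const ξ
  let T : Rn n →ₗ[ℝ] Lp ℝ (ENNReal.ofReal p) (volume : Measure (Rn n)) :=
    { toFun := fun ξ => (hg ξ).toLp _
      map_add' := fun ξ η => by
        rw [← MemLp.toLp_add]
        exact MemLp.toLp_congr _ _ (Filter.Eventually.of_forall fun x => inner_add_right _ _ _)
      map_smul' := fun c ξ => by
        rw [← MemLp.toLp_const_smul]
        exact MemLp.toLp_congr _ _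
          (Filter.Eventually.of_forall fun x => real_inner_smul_right _ _ _) }
  exact ⟨LinearMap.toContinuousLinearMap T, fun ξ => (Lp.enorm_toLp (hg ξ)).symm⟩

theorem MemW1.measurable_dirNorm {p : ℝ} (hp : 1 ≤ p) {f : Rn n → ℝ} (hf : MemW1 p f) :
    Measurable (dirNorm p f) := by
  have : Fact (1 ≤ ENNReal.ofReal p) := ⟨by simpa using hp⟩
  obtain ⟨T, hT⟩ := exists_dirNorm_eq_enorm hf
  rw [funext hT]
  exact (continuous_enorm.comp T.continuous).measurable

/-- A factor that is neither `0` nor `∞` avoids the indeterminate products, so negative exponents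
and all `x` are allowed. -/
theorem ofReal_mul_rpow {c : ℝ} (hc : 0 < c) (x : ℝ≥0∞) (z : ℝ) :
    (ENNReal.ofReal c * x) ^ z = ENNReal.ofReal (c ^ z) * x ^ z := by
  have h : ENNReal.ofReal c ≠ 0 := by simpa using hc
  rw [ENNReal.mul_rpow_eq_ite, ENNReal.ofReal_rpow_of_pos hc, if_neg]
  simp [h]

theorem dirNorm_smul (p : ℝ) (f : Rn n → ℝ) {c : ℝ} (hc : 0 < c) (ξ : Rn n) :
    dirNorm p f (c • ξ) = ENNReal.ofReal c * dirNorm p f ξ := by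
  have h : (fun x => ⟪weakGradient f x, c • ξ⟫_ℝ) = c • fun x => ⟪weakGradient f x, ξ⟫_ℝ := by
    ext x
    simp [real_inner_smul_right]
  rw [dirNorm, h, eLpNorm_const_smul, Real.enorm_of_nonneg hc.le]
  rfl

theorem MemW1.dirNorm_comp {p : ℝ} {L : Rn n ≃L[ℝ] Rn n}
    (hL : |LinearMap.det (L : Rn n →ₗ[ℝ] Rn n)| = 1) {f : Rn n → ℝ} (hf : MemW1 p f)
    (ξ : Rn n) : dirNorm p (f ∘ L) ξ = dirNorm p f (L ξ) := by
  have h : (fun x => ⟪weakGradient (f ∘ L) x, ξ⟫_ℝ) =ᵐ[volume]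
      (fun x => ⟪weakGradient f x, L ξ⟫_ℝ) ∘ L := by
    filter_upwards [hf.weakGradient_comp hL] with x hx
    rw [hx, ContinuousLinearMap.adjoint_inner_left]
    rfl
  rw [dirNorm, eLpNorm_congr_ae h, eLpNorm_comp_measurePreserving
    (hf.memLp.inner_const _).aestronglyMeasurable (measurePreserving_of_abs_det hL)]
  rfl

theorem MemW1.dirNorm_const_smul {p : ℝ} {f : Rn n → ℝ} (hf : MemW1 p f) {c : ℝ} (hc : 0 < c)
    (ξ : Rn n) : dirNorm p (c • f) ξ = ENNReal.ofReal c * dirNorm p f ξ := by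
  have h : (fun x => ⟪weakGradient (c • f) x, ξ⟫_ℝ) =ᵐ[volume]
      c • fun x => ⟪weakGradient f x, ξ⟫_ℝ := by
    filter_upwards [hf.weakGradient_const_smul c] with x hx
    simp [hx, real_inner_smul_left]
  rw [dirNorm, eLpNorm_congr_ae h, eLpNorm_const_smul, Real.enorm_of_nonneg hc.le]
  rfl

theorem enorm_inner_smul_rpow {c : ℝ} (hc : 0 < c) (x v : Rn n) (p : ℝ) :
    ‖⟪x, c • v⟫_ℝ‖ₑ ^ p = ENNReal.ofReal (c ^ p) * ‖⟪x, v⟫_ℝ‖ₑ ^ p := by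
  rw [real_inner_smul_right, enorm_mul, Real.enorm_of_nonneg hc.le, ofReal_mul_rpow hc]

theorem MemW1.affineEnergy_comp [Nontrivial (Rn n)] {p : ℝ} (hp : 1 ≤ p) {L : Rn n ≃L[ℝ] Rn n}
    (hL : |LinearMap.det (L : Rn n →ₗ[ℝ] Rn n)| = 1) {f : Rn n → ℝ} (hf : MemW1 p f) :
    affineEnergy p (f ∘ L) = affineEnergy p f := by
  have h := lintegral_sphere_comp (volume : Measure (Rn n))
    (F := fun x => dirNorm p f x ^ (-(n : ℝ))) ((hf.measurable_dirNorm hp).pow_const _)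
    (fun r hr x => by
      rw [dirNorm_smul p f hr, ofReal_mul_rpow hr, Real.rpow_neg hr.le, Real.rpow_natCast,
        finrank_euclideanSpace_fin]) (measurePreserving_of_abs_det hL)
  simp_rw [affineEnergy, hf.dirNorm_comp hL, h]

/-- The integrand has degree `(-n - p) + p = -n`, so the sphere integral is invariant once `⟨ξ, v⟩`
is written as `⟨Lξ, L⁻ᵀ v⟩`. -/
theorem MemW1.affineH_comp [Nontrivial (Rn n)] {p : ℝ} (hp : 1 ≤ p) {L : Rn n ≃L[ℝ] Rn n}
    (hL : |LinearMap.det (L : Rn n →ₗ[ℝ] Rn n)| = 1) {f : Rn n → ℝ} (hf : MemW1 p f)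
    (v : Rn n) : affineH p (f ∘ L) v = affineH p f (adjointEquiv L.symm v) := by
  have h := lintegral_sphere_comp (volume : Measure (Rn n))
    (F := fun x => dirNorm p f x ^ (-(n : ℝ) - p) * ‖⟪x, adjointEquiv L.symm v⟫_ℝ‖ₑ ^ p)
    (((hf.measurable_dirNorm hp).pow_const _).mul (by fun_prop))
    (fun r hr x => by
      rw [dirNorm_smul p f hr, ofReal_mul_rpow hr, real_inner_comm,
        enorm_inner_smul_rpow hr, real_inner_comm, finrank_euclideanSpace_fin, mul_mul_mul_comm,
        ← ENNReal.ofReal_mul (by positivity), ← Real.rpow_add hr, sub_add_cancel,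
        Real.rpow_neg hr.le, Real.rpow_natCast]) (measurePreserving_of_abs_det hL)
  have hi : ∀ ξ : Rn n, ⟪L ξ, adjointEquiv L.symm v⟫_ℝ = ⟪ξ, v⟫_ℝ := fun ξ => by
    rw [real_inner_comm, inner_adjointEquiv_left, L.symm_apply_apply, real_inner_comm]
  simp_rw [hi] at h
  simp_rw [affineH, hf.affineEnergy_comp hp hL, hf.dirNorm_comp hL, h]

theorem MemW1.affineEnergy_const_smul {p : ℝ} (hn : n ≠ 0) {f : Rn n → ℝ}
    (hf : MemW1 p f) {c : ℝ} (hc : 0 < c) :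
    affineEnergy p (c • f) = ENNReal.ofReal c * affineEnergy p f := by
  simp_rw [affineEnergy, hf.dirNorm_const_smul hc, ofReal_mul_rpow hc]
  rw [lintegral_const_mul' _ _ ENNReal.ofReal_ne_top, ofReal_mul_rpow (by positivity),
    ← Real.rpow_mul hc.le, mul_left_comm]
  congr 2
  have : (n : ℝ) ≠ 0 := by exact_mod_cast hn
  rw [show -(n : ℝ) * -(1 / (n : ℝ)) = 1 by field_simp, Real.rpow_one]

theorem MemW1.affineH_const_smul {p : ℝ} (hn : n ≠ 0) {f : Rn n → ℝ}
    (hf : MemW1 p f) {c : ℝ} (hc : 0 < c) : affineH p (c • f) = affineH p f := by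
  ext v
  simp_rw [affineH, hf.affineEnergy_const_smul hn hc, hf.dirNorm_const_smul hc,
    ofReal_mul_rpow hc, mul_assoc]
  rw [lintegral_const_mul' _ _ ENNReal.ofReal_ne_top]
  have h : ENNReal.ofReal (c ^ (p + n)) * ENNReal.ofReal (c ^ (-(n : ℝ) - p)) = 1 := by
    rw [← ENNReal.ofReal_mul (by positivity), ← Real.rpow_add hc,
      show p + (n : ℝ) + (-n - p) = 0 by ring, Real.rpow_zero, ENNReal.ofReal_one]
  congr 3
  rw [mul_left_comm, ← mul_assoc (ENNReal.ofReal (c ^ (p + n))), h, one_mul]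

theorem affineH_nonneg (p : ℝ) (f : Rn n → ℝ) (v : Rn n) : 0 ≤ affineH p f v :=
  ENNReal.toReal_nonneg

theorem affineH_smul {p : ℝ} (hp : p ≠ 0) (f : Rn n → ℝ) {c : ℝ} (hc : 0 < c) (v : Rn n) :
    affineH p f (c • v) = c * affineH p f v := by
  simp_rw [affineH, enorm_inner_smul_rpow hc, mul_left_comm _ (ENNReal.ofReal (c ^ p))]
  rw [lintegral_const_mul' _ _ ENNReal.ofReal_ne_top, mul_left_comm,
    ofReal_mul_rpow (by positivity), ← Real.rpow_mul hc.le, mul_one_div_cancel hp, Real.rpow_one,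
    ENNReal.toReal_mul, ENNReal.toReal_ofReal hc.le]

/-- Differentiating the 1-homogeneity relation; the rules used for `fderiv` also hold at points
where `affineH` is not differentiable. -/
theorem gradient_affineH_smul {p : ℝ} (hp : p ≠ 0) (f : Rn n → ℝ) {c : ℝ} (hc : 0 < c)
    (v : Rn n) : gradient (affineH p f) (c • v) = gradient (affineH p f) v := by
  have h : affineH p f = c⁻¹ • fun v => affineH p f (c • v) := by
    ext v
    rw [Pi.smul_apply, affineH_smul hp f hc, smul_eq_mul, inv_mul_cancel_left₀ hc.ne']
  have hd : fderiv ℝ (affineH p f) v = fderiv ℝ (affineH p f) (c • v) := by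
    conv_lhs => rw [h]
    rw [fderiv_const_smul_field, Pi.smul_apply, fderiv_comp_smul, smul_smul, inv_mul_cancel₀ hc.ne', one_smul]
  rw [gradient, gradient, hd]

theorem MemW1.affineField_comp_ae [Nontrivial (Rn n)] {p : ℝ} (hp : 1 ≤ p)
    {L : Rn n ≃L[ℝ] Rn n} (hL : |LinearMap.det (L : Rn n →ₗ[ℝ] Rn n)| = 1) {f : Rn n → ℝ}
    (hf : MemW1 p f) :
    affineField p (f ∘ L) =ᵐ[volume] fun x => L.symm (affineField p f (L x)) := by
  have hH : affineH p (f ∘ L) = fun v => affineH p f (adjointEquiv L.symm v) :=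
    funext (hf.affineH_comp hp hL)
  filter_upwards [hf.weakGradient_comp hL] with x hx
  have hv : adjointEquiv L.symm (weakGradient (f ∘ L) x) = weakGradient f (L x) := by
    rw [hx]
    exact (adjointEquiv L).symm_apply_apply _
  rw [affineField, hH, gradient_comp_adjointEquiv, affineField, map_smul]
  simp only [hv]

theorem MemW1.affineField_const_smul_ae {p : ℝ} (hp : 1 ≤ p) (hn : n ≠ 0) {f : Rn n → ℝ}
    (hf : MemW1 p f) {c : ℝ} (hc : 0 < c) :
    affineField p (c • f) =ᵐ[volume] fun x => c ^ (p - 1) • affineField p f x := by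
  have hp0 : p ≠ 0 := by linarith
  filter_upwards [hf.weakGradient_const_smul c] with x hx
  rw [affineField, hf.affineH_const_smul hn hc, hx, affineH_smul hp0 f hc,
    gradient_affineH_smul hp0 f hc, Real.mul_rpow hc.le (affineH_nonneg _ _ _), affineField,
    smul_smul]

/-! ### Differentiability of the gauge of the affine energy -/

theorem abs_inner_sphere_le (ξ : sphere (0 : Rn n) 1) (v : Rn n) : |⟪(ξ : Rn n), v⟫_ℝ| ≤ ‖v‖ := by
  have := abs_real_inner_le_norm (ξ : Rn n) v
  rwa [norm_eq_of_mem_sphere, one_mul] at this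

/-- The moment `v ↦ ∫ w(ξ) |⟨ξ, v⟩|^p dξ` of a weight `w` on the sphere. -/
def sphereMoment (p : ℝ) (w : sphere (0 : Rn n) 1 → ℝ) (v : Rn n) : ℝ :=
  ∫ ξ : sphere (0 : Rn n) 1, w ξ * |⟪(ξ : Rn n), v⟫_ℝ| ^ p ∂(volume : Measure (Rn n)).toSphere

theorem integrable_sphereMoment {p M : ℝ} (hp : 0 ≤ p) {w : sphere (0 : Rn n) 1 → ℝ}
    (hw : Measurable w) (hM : ∀ ξ, |w ξ| ≤ M) (v : Rn n) :
    Integrable (fun ξ : sphere (0 : Rn n) 1 => w ξ * |⟪(ξ : Rn n), v⟫_ℝ| ^ p)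
      (volume : Measure (Rn n)).toSphere := by
  refine Integrable.of_bound (C := M * ‖v‖ ^ p) (Measurable.aestronglyMeasurable (by fun_prop))
    (Filter.Eventually.of_forall fun ξ => ?_)
  rw [norm_mul, Real.norm_eq_abs, Real.norm_of_nonneg (by positivity)]
  have := (abs_nonneg _).trans (hM ξ)
  gcongr
  · exact hM ξ
  · exact abs_inner_sphere_le ξ v

theorem hasFDerivAt_abs_inner_rpow {p : ℝ} (hp : 1 < p) (ξ : sphere (0 : Rn n) 1) (c : ℝ)
    (v : Rn n) : HasFDerivAt (fun v => c * |⟪(ξ : Rn n), v⟫_ℝ| ^ p)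
      ((c * (p * |⟪(ξ : Rn n), v⟫_ℝ| ^ (p - 2) * ⟪(ξ : Rn n), v⟫_ℝ)) • innerSL ℝ (ξ : Rn n)) v := by
  have h1 : HasFDerivAt (fun v => ⟪(ξ : Rn n), v⟫_ℝ) (innerSL ℝ (ξ : Rn n)) v :=
    (innerSL ℝ (ξ : Rn n)).hasFDerivAt
  have h2 := ((hasDerivAt_abs_rpow ⟪(ξ : Rn n), v⟫_ℝ hp).comp_hasFDerivAt v h1).const_mul c
  rwa [smul_smul] at h2

theorem norm_fderiv_abs_inner_rpow_le {p M : ℝ} (hp : 1 < p) (ξ : sphere (0 : Rn n) 1) {c : ℝ}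
    (hc : |c| ≤ M) (v : Rn n) :
    ‖(c * (p * |⟪(ξ : Rn n), v⟫_ℝ| ^ (p - 2) * ⟪(ξ : Rn n), v⟫_ℝ)) • innerSL ℝ (ξ : Rn n)‖ ≤
      M * (p * ‖v‖ ^ (p - 1)) := by
  have h1 : ‖innerSL ℝ (ξ : Rn n)‖ = 1 := by
    rw [innerSL_apply_norm, norm_eq_of_mem_sphere]
  have h2 : |⟪(ξ : Rn n), v⟫_ℝ| ^ (p - 2) * |⟪(ξ : Rn n), v⟫_ℝ| = |⟪(ξ : Rn n), v⟫_ℝ| ^ (p - 1) := by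
    -- The exponent `p - 2` may be negative, so a vanishing inner product is treated apart; there
    -- both sides are `0` because `p > 1`.
    rcases eq_or_ne ⟪(ξ : Rn n), v⟫_ℝ 0 with h | h
    · rw [h, abs_zero, mul_zero, Real.zero_rpow (by linarith)]
    · rw [← Real.rpow_add_one (abs_ne_zero.2 h)]
      congr 1
      ring
  have h3 : |p * |⟪(ξ : Rn n), v⟫_ℝ| ^ (p - 2) * ⟪(ξ : Rn n), v⟫_ℝ| =
      p * |⟪(ξ : Rn n), v⟫_ℝ| ^ (p - 1) := by
    rw [abs_mul, abs_of_nonneg (by positivity), mul_assoc, h2]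
  rw [norm_smul, h1, mul_one, Real.norm_eq_abs, abs_mul, h3]
  have := (abs_nonneg _).trans hc
  gcongr
  exact abs_inner_sphere_le ξ v

/-- Differentiation under the integral: on the unit ball around `v` the derivatives of the integrand
are dominated by a constant, integrable since the sphere has finite measure. -/
theorem exists_hasFDerivAt_sphereMoment {p M : ℝ} (hp : 1 < p) {w : sphere (0 : Rn n) 1 → ℝ}
    (hw : Measurable w) (hM : ∀ ξ, |w ξ| ≤ M) (v : Rn n) :
    ∃ I' : Rn n →L[ℝ] ℝ, HasFDerivAt (sphereMoment p w) I' v ∧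
      ‖I'‖ ≤ M * (p * ‖v‖ ^ (p - 1)) * (volume : Measure (Rn n)).toSphere.real univ := by
  set F' : Rn n → sphere (0 : Rn n) 1 → Rn n →L[ℝ] ℝ := fun v ξ =>
    (w ξ * (p * |⟪(ξ : Rn n), v⟫_ℝ| ^ (p - 2) * ⟪(ξ : Rn n), v⟫_ℝ)) • innerSL ℝ (ξ : Rn n) with hF'
  refine ⟨∫ ξ, F' v ξ ∂(volume : Measure (Rn n)).toSphere, ?_, ?_⟩
  · refine hasFDerivAt_integral_of_dominated_of_fderiv_le (Metric.ball_mem_nhds v one_pos)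
      (bound := fun _ => M * (p * (‖v‖ + 1) ^ (p - 1)))
      (Filter.Eventually.of_forall fun u => Measurable.aestronglyMeasurable (by fun_prop))
      (integrable_sphereMoment (by linarith) hw hM v) ?_ ?_ (integrable_const _) ?_
    · have h1 : Measurable fun ξ : sphere (0 : Rn n) 1 =>
          w ξ * (p * |⟪(ξ : Rn n), v⟫_ℝ| ^ (p - 2) * ⟪(ξ : Rn n), v⟫_ℝ) := by fun_prop
      have h2 : Continuous fun ξ : sphere (0 : Rn n) 1 => innerSL ℝ (ξ : Rn n) := by fun_prop
      exact (h1.smul h2.measurable).aestronglyMeasurable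
    · refine Filter.Eventually.of_forall fun ξ u hu => ?_
      refine (norm_fderiv_abs_inner_rpow_le hp ξ (hM ξ) u).trans ?_
      have hu' : ‖u‖ ≤ ‖v‖ + 1 := by
        have := norm_le_norm_add_norm_sub' u v
        rw [mem_ball, dist_eq_norm] at hu
        linarith
      have := (abs_nonneg _).trans (hM ξ)
      gcongr
    · exact Filter.Eventually.of_forall fun ξ u _ => hasFDerivAt_abs_inner_rpow hp ξ (w ξ) u
  · exact norm_integral_le_of_norm_le_const
      (Filter.Eventually.of_forall fun ξ => norm_fderiv_abs_inner_rpow_le hp ξ (hM ξ) v)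

theorem sphereMoment_nonneg (p : ℝ) {w : sphere (0 : Rn n) 1 → ℝ} (hw : ∀ ξ, 0 ≤ w ξ)
    (v : Rn n) : 0 ≤ sphereMoment p w v :=
  integral_nonneg fun ξ => mul_nonneg (hw ξ) (by positivity)

theorem sphereMoment_pos {p M : ℝ} (hp : 0 < p) {w : sphere (0 : Rn n) 1 → ℝ}
    (hw : Measurable w) (hw0 : ∀ ξ, 0 < w ξ) (hM : ∀ ξ, w ξ ≤ M) {v : Rn n} (hv : v ≠ 0) :
    0 < sphereMoment p w v := by
  have hi := integrable_sphereMoment hp.le hw (fun ξ => by rw [abs_of_pos (hw0 ξ)]; exact hM ξ) v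
  rw [sphereMoment, integral_pos_iff_support_of_nonneg
    (fun ξ => mul_nonneg (hw0 ξ).le (by positivity)) hi]
  have hs : {ξ : sphere (0 : Rn n) 1 | ⟪(ξ : Rn n), v⟫_ℝ ≠ 0} ⊆
      Function.support fun ξ : sphere (0 : Rn n) 1 => w ξ * |⟪(ξ : Rn n), v⟫_ℝ| ^ p := fun ξ hξ =>
    (mul_pos (hw0 ξ) (Real.rpow_pos_of_pos (abs_pos.2 hξ) p)).ne'
  have ho : IsOpen {ξ : sphere (0 : Rn n) 1 | ⟪(ξ : Rn n), v⟫_ℝ ≠ 0} :=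
    isOpen_ne_fun (by fun_prop) continuous_const
  -- The open set where the integrand is positive contains the direction `v / ‖v‖`.
  refine lt_of_lt_of_le (ho.measure_pos _ ⟨⟨‖v‖⁻¹ • v, ?_⟩, ?_⟩) (measure_mono hs)
  · simp [norm_smul, hv]
  · simp [real_inner_smul_left, hv]

/-- If the affine gauge does not vanish identically, then its `p`-th power is a moment of a
positive bounded weight on the sphere. -/
theorem MemW1.affineH_eq_zero_or [Nontrivial (Rn n)] {p : ℝ} (hp : 1 ≤ p) {f : Rn n → ℝ}
    (hf : MemW1 p f) : (∀ v, affineH p f v = 0) ∨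
      ∃ (w : sphere (0 : Rn n) 1 → ℝ) (M : ℝ), Measurable w ∧ (∀ ξ, 0 < w ξ) ∧ (∀ ξ, w ξ ≤ M) ∧
        ∀ v, affineH p f v = sphereMoment p w v ^ (1 / p) := by
  have hp0 : 0 < p := by linarith
  have : Fact (1 ≤ ENNReal.ofReal p) := ⟨by simpa using hp⟩
  obtain ⟨T, hT⟩ := exists_dirNorm_eq_enorm hf
  have hn : 0 < (n : ℝ) := by
    have h : 0 < Module.finrank ℝ (Rn n) := Module.finrank_pos
    rw [finrank_euclideanSpace_fin] at h
    exact_mod_cast h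
  set K : ℝ≥0∞ := ENNReal.ofReal (affineConst n p) ^ (-(n : ℝ)) * affineEnergy p f ^ (p + n) with hK
  rcases eq_or_ne K 0 with hK0 | hK0
  · left
    intro v
    rw [affineH, ← hK, hK0, zero_mul, ENNReal.zero_rpow_of_pos (by positivity), ENNReal.toReal_zero]
  -- An infinite prefactor need not be excluded: the product is `0` or `∞`, and `toReal` sends both
  -- to `0`.
  rcases eq_or_ne K ⊤ with hKt | hKt
  · left
    intro v
    rw [affineH, ← hK, hKt]
    rcases eq_or_ne (∫⁻ ξ : sphere (0 : Rn n) 1, dirNorm p f ξ ^ (-(n : ℝ) - p) *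
      ‖⟪(ξ : Rn n), v⟫_ℝ‖ₑ ^ p ∂(volume : Measure (Rn n)).toSphere) 0 with h | h
    · rw [h, mul_zero, ENNReal.zero_rpow_of_pos (by positivity), ENNReal.toReal_zero]
    · rw [ENNReal.top_mul h, ENNReal.top_rpow_of_pos (by positivity), ENNReal.toReal_top]
  right
  -- A kernel makes the integral in the energy infinite, hence the energy and `K` zero, a case
  -- already settled.
  have hinj : T.toLinearMap.ker = ⊥ := by
    by_contra hker
    obtain ⟨z, hz, hz0⟩ := (Submodule.ne_bot_iff _).1 hker
    have htop := lintegral_sphere_enorm_rpow_eq_top (volume : Measure (Rn n)) T hz0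
      (LinearMap.mem_ker.1 hz)
    rw [finrank_euclideanSpace_fin] at htop
    refine hK0 ?_
    have hE : affineEnergy p f = 0 := by
      simp_rw [affineEnergy, hT]
      rw [htop, ENNReal.top_rpow_of_neg (by rw [neg_lt_zero]; positivity), mul_zero]
    rw [hK, hE, ENNReal.zero_rpow_of_pos (by positivity), mul_zero]
  -- An injective linear map on a finite-dimensional space is bounded below, so the negative powers
  -- of `‖T ξ‖` are bounded above on the sphere.
  obtain ⟨κ, hκ, hanti⟩ := LinearMap.exists_antilipschitzWith T.toLinearMap hinj
  have hκ' : (0 : ℝ) < κ := by exact_mod_cast hκ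
  have hlow : ∀ ξ : sphere (0 : Rn n) 1, (κ : ℝ)⁻¹ ≤ ‖T ξ‖ := fun ξ => by
    have h := hanti.le_mul_dist (ξ : Rn n) 0
    rw [dist_zero_right, norm_eq_of_mem_sphere, map_zero, dist_zero_right] at h
    rw [inv_le_iff_one_le_mul₀ hκ']
    simpa [mul_comm] using h
  have hpos : ∀ ξ : sphere (0 : Rn n) 1, 0 < ‖T ξ‖ := fun ξ => (inv_pos.2 hκ').trans_le (hlow ξ)
  have hKpos : 0 < K.toReal := ENNReal.toReal_pos hK0 hKt
  set w : sphere (0 : Rn n) 1 → ℝ := fun ξ => K.toReal * ‖T ξ‖ ^ (-(n : ℝ) - p) with hw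
  have hwm : Measurable w := by
    have : Measurable fun ξ : sphere (0 : Rn n) 1 => ‖T ξ‖ :=
      (T.continuous.comp continuous_subtype_val).norm.measurable
    fun_prop
  have hw0 : ∀ ξ, 0 < w ξ := fun ξ => mul_pos hKpos (Real.rpow_pos_of_pos (hpos ξ) _)
  have hwM : ∀ ξ, w ξ ≤ K.toReal * (κ : ℝ)⁻¹ ^ (-(n : ℝ) - p) := fun ξ =>
    mul_le_mul_of_nonneg_left
      (Real.rpow_le_rpow_of_nonpos (inv_pos.2 hκ') (hlow ξ) (by linarith)) hKpos.le
  refine ⟨w, _, hwm, hw0, hwM, fun v => ?_⟩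
  have hi := integrable_sphereMoment hp0.le hwm
    (fun ξ => by rw [abs_of_pos (hw0 ξ)]; exact hwM ξ) v
  have hpt : ∀ ξ : sphere (0 : Rn n) 1, K * (dirNorm p f ξ ^ (-(n : ℝ) - p) *
      ‖⟪(ξ : Rn n), v⟫_ℝ‖ₑ ^ p) = ENNReal.ofReal (w ξ * |⟪(ξ : Rn n), v⟫_ℝ| ^ p) := fun ξ => by
    rw [hT, ← ofReal_norm, ENNReal.ofReal_rpow_of_pos (hpos ξ), ← ofReal_norm,
      ENNReal.ofReal_rpow_of_nonneg (norm_nonneg _) hp0.le, hw,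
      ENNReal.ofReal_mul (hw0 ξ).le, ENNReal.ofReal_mul hKpos.le, ENNReal.ofReal_toReal hKt,
      mul_assoc K, Real.norm_eq_abs]
  rw [affineH, ← hK, ← lintegral_const_mul' _ _ hKt, lintegral_congr hpt,
    ← ofReal_integral_eq_lintegral_ofReal hi
      (Filter.Eventually.of_forall fun ξ => mul_nonneg (hw0 ξ).le (by positivity)),
    ← ENNReal.toReal_rpow, ← sphereMoment,
    ENNReal.toReal_ofReal (sphereMoment_nonneg p (fun ξ => (hw0 ξ).le) v)]

theorem hasFDerivAt_rpow_one_div {p : ℝ} {I : Rn n → ℝ} {I' : Rn n →L[ℝ] ℝ} {v : Rn n}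
    (hI : HasFDerivAt I I' v) (h0 : 0 < I v) :
    HasFDerivAt (fun v => I v ^ (1 / p)) ((1 / p * I v ^ (1 / p - 1)) • I') v :=
  hI.rpow_const (Or.inl h0.ne')

theorem MemW1.differentiableAt_affineH [Nontrivial (Rn n)] {p : ℝ} (hp : 1 < p) {f : Rn n → ℝ}
    (hf : MemW1 p f) {v : Rn n} (hv : v ≠ 0) : DifferentiableAt ℝ (affineH p f) v := by
  rcases hf.affineH_eq_zero_or hp.le with h | ⟨w, M, hw, hw0, hM, h⟩
  · rw [funext h]
    exact differentiableAt_const 0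
  · obtain ⟨I', hI, -⟩ := exists_hasFDerivAt_sphereMoment hp hw
      (fun ξ => by rw [abs_of_pos (hw0 ξ)]; exact hM ξ) v
    rw [funext h]
    exact (hasFDerivAt_rpow_one_div hI
      (sphereMoment_pos (by linarith) hw hw0 hM hv)).differentiableAt

theorem MemW1.measurable_affineH [Nontrivial (Rn n)] {p : ℝ} (hp : 1 < p) {f : Rn n → ℝ}
    (hf : MemW1 p f) : Measurable (affineH p f) := by
  rcases hf.affineH_eq_zero_or hp.le with h | ⟨w, M, hw, hw0, hM, h⟩
  · rw [funext h]
    exact measurable_const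
  · rw [funext h]
    have hc : Continuous (sphereMoment p w) := continuous_iff_continuousAt.2 fun v => by
      obtain ⟨I', hI, -⟩ := exists_hasFDerivAt_sphereMoment hp hw
        (fun ξ => by rw [abs_of_pos (hw0 ξ)]; exact hM ξ) v
      exact hI.continuousAt
    exact hc.measurable.pow_const _

/-- The field is `∇(H_f^p) / p`, so the derivative bound for the moment applies and the powers of
`H_f` disappear. -/
theorem MemW1.exists_norm_affineH_rpow_smul_gradient_le [Nontrivial (Rn n)] {p : ℝ} (hp : 1 < p)
    {f : Rn n → ℝ} (hf : MemW1 p f) :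
    ∃ C, ∀ v, ‖affineH p f v ^ (p - 1) • gradient (affineH p f) v‖ ≤ C * (1 + ‖v‖) ^ p := by
  have hp0 : 0 < p := by linarith
  rcases hf.affineH_eq_zero_or hp.le with h | ⟨w, M, hw, hw0, hM, h⟩
  · refine ⟨0, fun v => ?_⟩
    rw [h v, Real.zero_rpow (by linarith), zero_smul, norm_zero, zero_mul]
  set S := (volume : Measure (Rn n)).toSphere.real univ with hS
  have hwa : ∀ ξ, |w ξ| ≤ |M| := fun ξ => by
    rw [abs_of_pos (hw0 ξ)]
    exact (hM ξ).trans (le_abs_self M)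
  refine ⟨|M| * S, fun v => ?_⟩
  -- The power `H_f(0)^(p - 1) = 0` kills the field at the origin, whatever value `gradient` takes
  -- there.
  rcases eq_or_ne v 0 with rfl | hv
  · have h0 : sphereMoment p w 0 = 0 := by simp [sphereMoment, Real.zero_rpow hp0.ne']
    rw [h 0, h0, Real.zero_rpow (by positivity), Real.zero_rpow (by linarith), zero_smul, norm_zero]
    positivity
  obtain ⟨I', hI, hI'⟩ := exists_hasFDerivAt_sphereMoment hp hw hwa v
  have hpos := sphereMoment_pos hp0 hw hw0 hM hv
  have hd := hasFDerivAt_rpow_one_div (p := p) hI hpos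
  have hone : (sphereMoment p w v ^ (1 / p)) ^ (p - 1) * sphereMoment p w v ^ (1 / p - 1) = 1 := by
    rw [← Real.rpow_mul hpos.le, ← Real.rpow_add hpos,
      show 1 / p * (p - 1) + (1 / p - 1) = 0 by field_simp; ring, Real.rpow_zero]
  have hle : ‖v‖ ^ (p - 1) ≤ (1 + ‖v‖) ^ p :=
    (Real.rpow_le_rpow (norm_nonneg v) (by linarith) (by linarith)).trans
      (Real.rpow_le_rpow_of_exponent_le (by linarith [norm_nonneg v]) (by linarith))
  rw [norm_smul, norm_gradient, h v, funext h, hd.fderiv, norm_smul,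
    Real.norm_of_nonneg (by positivity), Real.norm_of_nonneg (by positivity)]
  calc (sphereMoment p w v ^ (1 / p)) ^ (p - 1) *
        (1 / p * sphereMoment p w v ^ (1 / p - 1) * ‖I'‖)
      = (sphereMoment p w v ^ (1 / p)) ^ (p - 1) * sphereMoment p w v ^ (1 / p - 1) *
        (1 / p * ‖I'‖) := by ring
    _ = 1 / p * ‖I'‖ := by rw [hone, one_mul]
    _ ≤ 1 / p * (|M| * (p * ‖v‖ ^ (p - 1)) * S) := by gcongr
    _ = |M| * S * ‖v‖ ^ (p - 1) := by field_simp
    _ ≤ |M| * S * (1 + ‖v‖) ^ p := by gcongr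

/-! ### The affine `p`-Laplacian: invariance and homogeneity -/

theorem MemW1.locallyIntegrable_affineField [Nontrivial (Rn n)] {p : ℝ} (hp : 1 < p)
    {f : Rn n → ℝ} (hf : MemW1 p f) : LocallyIntegrable (affineField p f) := by
  obtain ⟨C, hC⟩ := hf.exists_norm_affineH_rpow_smul_gradient_le hp
  exact locallyIntegrable_comp_of_growth (p := p) (g := weakGradient f)
    (Φ := fun v => affineH p f v ^ (p - 1) • gradient (affineH p f) v) (by linarith) hf.memLp
    (((hf.measurable_affineH hp).pow_const _).smul (measurable_gradient _)) hC

theorem MemW1.affineLaplacian_comp [Nontrivial (Rn n)] {p : ℝ} (hp : 1 < p)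
    {L : Rn n ≃L[ℝ] Rn n} (hL : |LinearMap.det (L : Rn n →ₗ[ℝ] Rn n)| = 1) {f : Rn n → ℝ}
    (hf : MemW1 p f) : affineLaplacian p (f ∘ L) = compLinear (affineLaplacian p f) L := by
  rw [affineLaplacian, affineLaplacian,
    compLinear_neg_divergence hL (hf.locallyIntegrable_affineField hp),
    divergence_congr ((hf.comp hL).locallyIntegrable_affineField hp)
      (hf.affineField_comp_ae hp.le hL)]

theorem MemW1.affineLaplacian_const_smul [Nontrivial (Rn n)] {p : ℝ} (hp : 1 < p) (hn : n ≠ 0)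
    {f : Rn n → ℝ} (hf : MemW1 p f) {c : ℝ} (hc : 0 < c) :
    affineLaplacian p (c • f) = c ^ (p - 1) • affineLaplacian p f := by
  rw [affineLaplacian, affineLaplacian,
    divergence_congr ((hf.const_smul c).locallyIntegrable_affineField hp)
      (hf.affineField_const_smul_ae hp.le hn hc),
    divergence_smul (hf.locallyIntegrable_affineField hp), smul_neg]

end AffinePLaplace

end

/-! ### The main theorem -/

open AffinePLaplace in
theorem proposition4p2 (n : ℕ) (hn : 1 ≤ n) (p : ℝ) (hp : 1 < p)
    (A : Matrix.SpecialLinearGroup (Fin n) ℝ) (f : Rn n → ℝ) (hf : MemW1 p f) :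
    -- the functions `f_A` and `c f` belong to the space and the operators make sense
    (MemW1 p (f ∘ slMap A) ∧ (∀ c : ℝ, 0 < c → MemW1 p (c • f)) ∧
      (∀ v : Rn n, v ≠ 0 → DifferentiableAt ℝ (affineH p f) v) ∧
      LocallyIntegrable (affineField p f)) ∧
    -- behaviour of the Wulff Laplacian under `A`
    (∀ K : ConvexBody (Rn n), (0 : Rn n) ∈ interior (K : Set (Rn n)) →
      LocallyIntegrable (wulffField p (slMap A '' (K : Set (Rn n))) f) ∧
      LocallyIntegrable (wulffField p (K : Set (Rn n)) (f ∘ slMap A)) ∧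
      (WulffDefined p (slMap A '' (K : Set (Rn n))) f ↔
        WulffDefined p (K : Set (Rn n)) (f ∘ slMap A)) ∧
      wulffLaplacian p (slMap A '' (K : Set (Rn n))) f =
        compLinear (wulffLaplacian p (K : Set (Rn n)) (f ∘ slMap A)) (slMap A).symm) ∧
    -- `SL_n`-invariance
    affineLaplacian p (f ∘ slMap A) = compLinear (affineLaplacian p f) (slMap A) ∧
    -- `(p-1)`-homogeneity
    (∀ c : ℝ, 0 < c → affineLaplacian p (c • f) = c ^ (p - 1) • affineLaplacian p f) := by
  have hL := abs_det_slMap A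
  have hn0 : n ≠ 0 := by omega
  have : Nontrivial (Rn n) := Module.nontrivial_of_finrank_pos (R := ℝ) (by
    rw [finrank_euclideanSpace_fin]
    omega)
  refine ⟨⟨hf.comp hL, fun c _ => hf.const_smul c, fun v hv => hf.differentiableAt_affineH hp hv,
    hf.locallyIntegrable_affineField hp⟩, fun K hK => ?_, hf.affineLaplacian_comp hp hL,
    fun c hc => hf.affineLaplacian_const_smul hp hn0 hc⟩
  have h0 := interior_subset hK
  have hb := K.isCompact.isBounded
  exact ⟨locallyIntegrable_wulffField hp
      (K.isCompact.image (slMap A).continuous).isBounded ⟨0, h0, map_zero _⟩ hf,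
    locallyIntegrable_wulffField hp hb h0 (hf.comp hL),
    wulffDefined_image_iff _ hL hf, wulffLaplacian_image hp hb h0 hL hf⟩
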